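/- Let $\mathbb{K}\in\{\mathbb{R},\mathbb{C}\}$, let $I$ be a nonempty set, and let $(X_i)_{i\in I}$, $(Y_i)_{i\in I}$, $(Z_i)_{i\in I}$ be families of normed spaces over $\mathbb{K}$. For each $i$ let $U_i\subseteq X_i$ be open and nonempty, and let $V_i\subseteq Y_i$ be open, nonempty and star-shaped with center $0$. Products of normed spaces carry the maximum norm. *Weighted restricted products.* For an open set $U$ in a normed space, $f:U\to\mathbb{R}\cup\{\infty\}$, $\ell\in\mathbb{N}$ and a $C^\ell$-map $\phi$ on $U$ (in the sense of Fréchet) put $\|\phi\|_{f,\ell}:=\sup_{x\in U}|f(x)|\,\|D^{\ell}\phi(x)\|_{op}\in[0,\infty]$ (with $\infty\cdot 0=0$). Let $\mathcal{W}$ be a nonempty set of functions $\bigsqcup_{i} U_i\to\mathbb{R}\cup\{\infty\}$; for a function $f$ on $\bigsqcup_i U_i$ write $f_i:=f|_{U_i}$ and $\|(\phi_i)_i\|_{f,\ell}:=\sup_{i}\|\phi_i\|_{f_i,\ell}$. For $k\in\mathbb{N}\cup\{\infty\}$ and a family $(E_i)_i$ of normed spaces let $C^k_{\mathcal{W}}(U_i,E_i)_{i}$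 be the space of all families $(\phi_i)_i$ of $C^k$-maps $\phi_i:U_i\to E_i$ with $\|(\phi_i)_i\|_{f,\ell}<\infty$ for all $f\in\mathcal{W}$ and $\ell\in\mathbb{N}$, $\ell\le k$, with the locally convex topology defined by these seminorms. The maximal extension $\mathcal{W}_{\max}$ of $\mathcal{W}$ is the set of all $g:\bigsqcup_i U_i\to\mathbb{R}\cup\{\infty\}$ such that $\|\cdot\|_{g,0}$ is a (finite) continuous seminorm on $C^0_{\mathcal{W}}(U_i,E_i)_i$ for every family $(E_i)_i$ of normed spaces. *Adjusting weights.* Let $\mathcal{W}$ contain a function $\omega:\bigsqcup_i U_i\to\mathbb{R}$ that is an adjusting weight for $(V_i)_i$, that is, for each $i\in I$, $$\sup_{x\in U_i}|\omega(x)|<\infty\quad\text{and}\quad \inf_{x\in U_i}|\omega(x)|\ \ge\ \max\Bigl(\tfrac{1}{\operatorname{dist}(0,\partial V_i)},1\Bigr),$$ where $\operatorname{dist}(0,\emptyset)=\infty$ and $\tfrac1\infty=0$. For $k\in\mathbb{N}\cup\{\infty\}$ let $\mathcal{O}^k_\omega$ be the set of all $(\gamma_i)_i\in C^k_{\mathcal{W}}(U_i,Y_i)_i$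 for which there is $r>0$ such that, for all $i\in I$ and $x\in U_i$, the ball in $Y_i$ with center $\gamma_i(x)$ and radius $r/|\omega(x)|$ is contained in $V_i$. **Proposition.** For each $i\in I$ let $\beta_i:U_i\times V_i\to Z_i$ be a $C^\infty$-map (in the sense of Fréchet) with $\beta_i(x,0)=0$ for all $x\in U_i$. Assume that for all $f\in\mathcal{W}$ and all integers $\ell\ge 1$ there is $g\in\mathcal{W}_{\max}$ such that $$\|\beta_i\|_{1,\ell}\;|f_i(x)|\ \le\ |g_i(x)|\qquad\text{for all } i\in I,\ x\in U_i,$$ where $\|\beta_i\|_{1,\ell}=\sup_{(x,y)\in U_i\times V_i}\|D^\ell\beta_i(x,y)\|_{op}$. Then for every $k\in\mathbb{N}\cup\{\infty\}$ the set $\mathcal{O}^k_\omega$ is open and nonempty in $C^k_{\mathcal{W}}(U_i,Y_i)_i$, its elements $(\gamma_i)_i$ satisfy $\gamma_i(U_i)\subseteq V_i$, and the map $$\mathcal{O}^k_\omega\to C^k_{\mathcal{W}}(U_i,Z_i)_i,\qquad (\gamma_i)_i\mapsto\bigl(x\mapsto\beta_i(x,\gamma_i(x))\bigr)_i$$ is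 defined (it takes values in $C^k_{\mathcal{W}}(U_i,Z_i)_i$) and smooth in the sense of Keller's $C^\infty_c$-theory: it is $C^n$ for every $n\in\mathbb{N}$, where a map $h$ on an open subset $\Omega$ of a locally convex space $E$ is $C^0$ if it is continuous, and $C^{n+1}$ if all directional derivatives $dh(u,v)=\lim_{t\to0,\,t\ne0,\,t\in\mathbb{K}}t^{-1}(h(u+tv)-h(u))$ exist for $u\in\Omega$, $v\in E$, and $dh$ is continuous and $C^n$ on $\Omega\times E$. -/

import Mathlib

open Set Filter Topology TopologicalSpace
open scoped ENNReal

universe u𝕂 uι uX uY uZ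

noncomputable section

namespace WeightedProducts

/-! ### Smooth maps between locally convex spaces (Keller's `C^k_c`-theory) -/

section Bastiani

/-- `IsCOn 𝕂 n Ω f`: the restriction of `f` to the open set `Ω` is `C^n`. A `C^0`-map is a
continuous map; a map is `C^(n+1)` if all directional derivatives
`df(u, x) = lim_{t → 0, t ≠ 0} (f(u + t x) - f(u)) / t` (`t` in `𝕂`, `u ∈ Ω`, `x ∈ E`) exist,
`df` is continuous on `Ω × E`, and `df` is `C^n` on `Ω × E`.
Only the values of `f` on `Ω` matter, as `Ω` is open. -/
def IsCOn (𝕂 : Type*) [RCLike 𝕂] {F : Type*} [AddCommGroup F] [Module 𝕂 F] [TopologicalSpace F] :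
    ℕ → ∀ {E : Type*} [AddCommGroup E] [Module 𝕂 E] [TopologicalSpace E],
      Set E → (E → F) → Prop
  | 0, _, _, _, _, Ω, f => ContinuousOn f Ω
  | n + 1, E, _, _, _, Ω, f => ∃ df : E × E → F,
      (∀ u ∈ Ω, ∀ x : E,
        Tendsto (fun t : 𝕂 => t⁻¹ • (f (u + t • x) - f u)) (𝓝[≠] 0) (𝓝 (df (u, x)))) ∧
      ContinuousOn df (Ω ×ˢ univ) ∧
      IsCOn 𝕂 n (Ω ×ˢ (univ : Set E)) df

/-- Smoothness in the sense of Keller's `C^∞_c`-theory (Bastiani). -/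
def IsSmoothOn (𝕂 : Type*) [RCLike 𝕂] {E F : Type*} [AddCommGroup E] [Module 𝕂 E]
    [TopologicalSpace E] [AddCommGroup F] [Module 𝕂 F] [TopologicalSpace F]
    (Ω : Set E) (f : E → F) : Prop :=
  ∀ n : ℕ, IsCOn 𝕂 n Ω f

end Bastiani

/-! ### Weights and weighted quasinorms -/

/-- The absolute value `ℝ ∪ {∞} → [0, ∞]`. -/
def wabs (a : WithTop ℝ) : ℝ≥0∞ := WithTop.map Real.nnabs a

section Single

variable (𝕂 : Type*) [RCLike 𝕂] {X Y : Type*} [NormedAddCommGroup X] [NormedSpace 𝕂 X]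
  [NormedAddCommGroup Y] [NormedSpace 𝕂 Y]

/-- The quasinorm `‖φ‖_{f,ℓ} = sup {|f(x)| ‖D^ℓ φ(x)‖ : x ∈ U}`, for a weight `f : U → ℝ ∪ {∞}`
and a function `φ` of which only the restriction to the open set `U` matters (with `∞ * 0 = 0`). -/
def qnorm (U : Opens X) (f : U → WithTop ℝ) (ℓ : ℕ) (φ : X → Y) : ℝ≥0∞ :=
  ⨆ x : U, wabs (f x) * ‖iteratedFDerivWithin 𝕂 ℓ φ (U : Set X) (x : X)‖ₑ

/-- The open set `U × V` in `X × Y`. -/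
def opensProd {X Y : Type*} [TopologicalSpace X] [TopologicalSpace Y] (U : Opens X)
    (V : Opens Y) : Opens (X × Y) :=
  ⟨(U : Set X) ×ˢ (V : Set Y), U.isOpen.prod V.isOpen⟩

/-- Extension by `0` of a function on `U`; used only to speak of derivatives at points of the
open set `U`. -/
def ext0 {X Y : Type*} [TopologicalSpace X] [Zero Y] (U : Opens X) (φ : U → Y) : X → Y :=
  Function.extend Subtype.val φ 0

theorem ext0_apply {X Y : Type*} [TopologicalSpace X] [Zero Y] (U : Opens X) (φ : U → Y) (x : U) :
    ext0 U φ x = φ x :=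
  Subtype.val_injective.extend_apply φ 0 x

theorem ext0_zero {X Y : Type*} [TopologicalSpace X] [Zero Y] (U : Opens X) :
    ext0 U (0 : U → Y) = 0 :=
  Function.extend_zero _

theorem ext0_add {X Y : Type*} [TopologicalSpace X] [AddMonoid Y] (U : Opens X) (φ ψ : U → Y) :
    ext0 U (φ + ψ) = ext0 U φ + ext0 U ψ := by
  have := Function.extend_add (Subtype.val : U → X) φ ψ (0 : X → Y) 0
  simpa [ext0] using this

theorem ext0_smul {𝕂 X Y : Type*} [TopologicalSpace X] [MonoidWithZero 𝕂] [AddMonoid Y]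
    [DistribMulAction 𝕂 Y] (U : Opens X) (c : 𝕂) (φ : U → Y) : ext0 U (c • φ) = c • ext0 U φ := by
  have := Function.extend_smul c (Subtype.val : U → X) φ (0 : X → Y)
  simpa [ext0] using this

/-- Star-shaped with center `0`. -/
def StarShaped (V : Set Y) : Prop :=
  ∀ y ∈ V, ∀ t : ℝ, 0 ≤ t → t ≤ 1 → (t : 𝕂) • y ∈ V

variable {𝕂}

theorem qnorm_add_le (U : Opens X) (f : U → WithTop ℝ) (ℓ : ℕ) {φ ψ : X → Y}
    (hφ : ContDiffOn 𝕂 ℓ φ U) (hψ : ContDiffOn 𝕂 ℓ ψ U) :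
    qnorm 𝕂 U f ℓ (φ + ψ) ≤ qnorm 𝕂 U f ℓ φ + qnorm 𝕂 U f ℓ ψ := by
  refine iSup_le fun x => ?_
  rw [iteratedFDerivWithin_add_apply (hφ x x.2) (hψ x x.2) U.isOpen.uniqueDiffOn x.2]
  calc _ ≤ wabs (f x) * (‖iteratedFDerivWithin 𝕂 ℓ φ (U : Set X) (x : X)‖ₑ
        + ‖iteratedFDerivWithin 𝕂 ℓ ψ (U : Set X) (x : X)‖ₑ) := by
        exact mul_le_mul_right (enorm_add_le (iteratedFDerivWithin 𝕂 ℓ φ (U : Set X) (x : X))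
          (iteratedFDerivWithin 𝕂 ℓ ψ (U : Set X) (x : X))) _
    _ ≤ _ := by
      rw [mul_add]
      exact add_le_add
        (le_iSup (fun x : U => wabs (f x) * ‖iteratedFDerivWithin 𝕂 ℓ φ (U : Set X) (x : X)‖ₑ) x)
        (le_iSup (fun x : U => wabs (f x) * ‖iteratedFDerivWithin 𝕂 ℓ ψ (U : Set X) (x : X)‖ₑ) x)

theorem qnorm_smul (U : Opens X) (f : U → WithTop ℝ) (ℓ : ℕ) (c : 𝕂) {φ : X → Y}
    (hφ : ContDiffOn 𝕂 ℓ φ U) :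
    qnorm 𝕂 U f ℓ (c • φ) = ‖c‖ₑ * qnorm 𝕂 U f ℓ φ := by
  unfold qnorm
  rw [ENNReal.mul_iSup]
  congr 1 with x
  rw [iteratedFDerivWithin_const_smul_apply (hφ x x.2) U.isOpen.uniqueDiffOn x.2, enorm_smul]
  ring

end Single

/-! ### Weighted restricted products -/

section Products

variable (𝕂 : Type*) [RCLike 𝕂] {ι : Type*} {X : ι → Type*} [∀ i, NormedAddCommGroup (X i)]
  [∀ i, NormedSpace 𝕂 (X i)] (U : ∀ i, Opens (X i))

/-- Weights `⊔ᵢ Uᵢ → ℝ ∪ {∞}` on the disjoint union of the `Uᵢ`. -/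
abbrev Weight {ι : Type*} {X : ι → Type*} [∀ i, TopologicalSpace (X i)]
    (U : ∀ i, Opens (X i)) : Type _ := (Σ i, U i) → WithTop ℝ

variable (Y : ι → Type*) [∀ i, NormedAddCommGroup (Y i)] [∀ i, NormedSpace 𝕂 (Y i)]

variable {U Y} in
/-- The quasinorm `‖(φᵢ)ᵢ‖_{f,ℓ} = supᵢ ‖φᵢ‖_{fᵢ,ℓ}`. -/
def famNorm (f : Weight U) (ℓ : ℕ) (φ : ∀ i, U i → Y i) : ℝ≥0∞ :=
  ⨆ i, qnorm 𝕂 (U i) (fun x => f ⟨i, x⟩) ℓ (ext0 (U i) (φ i))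

variable {𝕂 U Y} in
theorem famNorm_add_le (f : Weight U) (ℓ : ℕ) {φ ψ : ∀ i, U i → Y i}
    (hφ : ∀ i, ContDiffOn 𝕂 ℓ (ext0 (U i) (φ i)) (U i))
    (hψ : ∀ i, ContDiffOn 𝕂 ℓ (ext0 (U i) (ψ i)) (U i)) :
    famNorm 𝕂 f ℓ (φ + ψ) ≤ famNorm 𝕂 f ℓ φ + famNorm 𝕂 f ℓ ψ := by
  refine iSup_le fun i => ?_
  rw [Pi.add_apply, ext0_add]
  exact (qnorm_add_le _ _ _ (hφ i) (hψ i)).trans (add_le_add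
    (le_iSup (fun i => qnorm 𝕂 (U i) (fun x => f ⟨i, x⟩) ℓ (ext0 (U i) (φ i))) i)
    (le_iSup (fun i => qnorm 𝕂 (U i) (fun x => f ⟨i, x⟩) ℓ (ext0 (U i) (ψ i))) i))

variable {𝕂 U Y} in
theorem famNorm_smul (f : Weight U) (ℓ : ℕ) (c : 𝕂) {φ : ∀ i, U i → Y i}
    (hφ : ∀ i, ContDiffOn 𝕂 ℓ (ext0 (U i) (φ i)) (U i)) :
    famNorm 𝕂 f ℓ (c • φ) = ‖c‖ₑ * famNorm 𝕂 f ℓ φ := by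
  unfold famNorm
  rw [ENNReal.mul_iSup]
  congr 1 with i
  rw [Pi.smul_apply, ext0_smul, qnorm_smul _ _ _ _ (hφ i)]

/-- The underlying vector space of the weighted restricted product: all families of
`C^k`-maps `γᵢ : Uᵢ → Yᵢ` (in the Fréchet sense) with `‖(γᵢ)ᵢ‖_{f,ℓ} < ∞` for all `f ∈ W` and
`ℓ ∈ ℕ` with `ℓ ≤ k`. -/
def weightedSubmodule (W : Set (Weight U)) (k : ℕ∞) : Submodule 𝕂 (∀ i, U i → Y i) where
  carrier := {γ | (∀ i, ContDiffOn 𝕂 k (ext0 (U i) (γ i)) (U i)) ∧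
    ∀ f ∈ W, ∀ ℓ : ℕ, (ℓ : ℕ∞) ≤ k → famNorm 𝕂 f ℓ γ < ∞}
  zero_mem' := by
    have h0 : ∀ i, ContDiffOn 𝕂 k (ext0 (U i) ((0 : ∀ i, U i → Y i) i)) (U i) := fun i => by
      rw [Pi.zero_apply, ext0_zero]
      exact contDiffOn_const (c := (0 : Y i))
    refine ⟨h0, fun f _ ℓ hℓ => ?_⟩
    have := famNorm_smul (𝕂 := 𝕂) f ℓ (0 : 𝕂) (φ := (0 : ∀ i, U i → Y i))
      fun i => (h0 i).of_le (by exact_mod_cast hℓ)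
    rw [zero_smul] at this
    rw [this, enorm_zero, zero_mul]
    exact ENNReal.zero_lt_top
  add_mem' := by
    intro γ η hγ hη
    refine ⟨fun i => ?_, fun f hf ℓ hℓ => ?_⟩
    · rw [Pi.add_apply, ext0_add]
      exact (hγ.1 i).add (hη.1 i)
    · exact (famNorm_add_le (𝕂 := 𝕂) f ℓ (fun i => (hγ.1 i).of_le (by exact_mod_cast hℓ))
        (fun i => (hη.1 i).of_le (by exact_mod_cast hℓ))).trans_lt
        (ENNReal.add_lt_top.2 ⟨hγ.2 f hf ℓ hℓ, hη.2 f hf ℓ hℓ⟩)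
  smul_mem' := by
    intro c γ hγ
    refine ⟨fun i => ?_, fun f hf ℓ hℓ => ?_⟩
    · rw [Pi.smul_apply, ext0_smul]
      exact (hγ.1 i).const_smul c
    · rw [famNorm_smul f ℓ c fun i => (hγ.1 i).of_le (by exact_mod_cast hℓ)]
      exact ENNReal.mul_lt_top enorm_lt_top (hγ.2 f hf ℓ hℓ)

/-- The weighted restricted product `C^k_W(Uᵢ, Yᵢ)ᵢ`. It is a type of its own, as its topology
is not the one of pointwise convergence. -/
def WProd (W : Set (Weight U)) (k : ℕ∞) : Type _ := weightedSubmodule 𝕂 U Y W k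

namespace WProd

variable {𝕂 U Y} {W : Set (Weight U)} {k : ℕ∞}

instance : AddCommGroup (WProd 𝕂 U Y W k) :=
  inferInstanceAs (AddCommGroup (weightedSubmodule 𝕂 U Y W k))

instance : Module 𝕂 (WProd 𝕂 U Y W k) :=
  inferInstanceAs (Module 𝕂 (weightedSubmodule 𝕂 U Y W k))

/-- The family of functions underlying an element of the weighted restricted product. -/
def toFam (γ : WProd 𝕂 U Y W k) : ∀ i, U i → Y i :=
  (show weightedSubmodule 𝕂 U Y W k from γ).1

theorem toFam_mem (γ : WProd 𝕂 U Y W k) : γ.toFam ∈ weightedSubmodule 𝕂 U Y W k :=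
  (show weightedSubmodule 𝕂 U Y W k from γ).2

theorem toFam_add (γ η : WProd 𝕂 U Y W k) : (γ + η).toFam = γ.toFam + η.toFam := rfl

theorem toFam_smul (c : 𝕂) (γ : WProd 𝕂 U Y W k) : (c • γ).toFam = c • γ.toFam := rfl

theorem contDiffOn (γ : WProd 𝕂 U Y W k) {ℓ : ℕ} (hℓ : (ℓ : ℕ∞) ≤ k) (i : ι) :
    ContDiffOn 𝕂 ℓ (ext0 (U i) (γ.toFam i)) (U i) :=
  (γ.toFam_mem.1 i).of_le (by exact_mod_cast hℓ)

variable (𝕂 U Y W k) in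
/-- The defining seminorms `‖·‖_{f,ℓ}`, `f ∈ W`, `ℓ ∈ ℕ`, `ℓ ≤ k`. -/
def seminorms : SeminormFamily 𝕂 (WProd 𝕂 U Y W k) (W × {ℓ : ℕ // (ℓ : ℕ∞) ≤ k}) := fun p =>
  Seminorm.of (fun γ => (famNorm 𝕂 p.1.1 p.2.1 γ.toFam).toReal)
    (fun γ η => by
      have h1 := (γ.toFam_mem.2 p.1.1 p.1.2 p.2.1 p.2.2).ne
      have h2 := (η.toFam_mem.2 p.1.1 p.1.2 p.2.1 p.2.2).ne
      rw [toFam_add, ← ENNReal.toReal_add h1 h2]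
      exact ENNReal.toReal_mono (ENNReal.add_ne_top.2 ⟨h1, h2⟩)
        (famNorm_add_le _ _ (γ.contDiffOn p.2.2) (η.contDiffOn p.2.2)))
    (fun c γ => by
      rw [toFam_smul, famNorm_smul _ _ _ (γ.contDiffOn p.2.2), ENNReal.toReal_mul, toReal_enorm])

/-- The locally convex topology generated by the seminorms `‖·‖_{f,ℓ}`. -/
instance : TopologicalSpace (WProd 𝕂 U Y W k) :=
  ⨅ p, (seminorms 𝕂 U Y W k p).toSeminormedAddCommGroup.toUniformSpace.toTopologicalSpace

instance : IsTopologicalAddGroup (WProd 𝕂 U Y W k) :=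
  topologicalAddGroup_iInf fun p =>
    @SeminormedAddCommGroup.toIsTopologicalAddGroup _
      (seminorms 𝕂 U Y W k p).toSeminormedAddCommGroup

/-- The topology is the one generated by the seminorms, in Mathlib's sense. -/
theorem withSeminorms (W : Set (Weight U)) : WithSeminorms (seminorms 𝕂 U Y W k) :=
  (SeminormFamily.withSeminorms_iff_topologicalSpace_eq_iInf _).2 rfl

end WProd

end Products

/-- `IsExtWeight 𝕂 U W g`: the function `g` belongs to the maximal extension of `W`, that is,
`‖·‖_{g,0}` is a continuous seminorm (it is finite, and continuous) on `C^0_W(Uᵢ, Eᵢ)ᵢ`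
for every family `(Eᵢ)ᵢ` of normed spaces. -/
def IsExtWeight (𝕂 : Type u𝕂) [RCLike 𝕂] {ι : Type uι} {X : ι → Type uX}
    [∀ i, NormedAddCommGroup (X i)] [∀ i, NormedSpace 𝕂 (X i)] (U : ∀ i, Opens (X i))
    (W : Set (Weight U)) (g : Weight U) : Prop :=
  ∀ (E : ι → Type uY) [∀ i, NormedAddCommGroup (E i)] [∀ i, NormedSpace 𝕂 (E i)],
    (∀ γ : WProd 𝕂 U E W 0, famNorm 𝕂 g 0 γ.toFam < ∞) ∧
    Continuous fun γ : WProd 𝕂 U E W 0 => (famNorm 𝕂 g 0 γ.toFam).toReal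

section Adjusting

variable {ι : Type*} {X Y : ι → Type*} [∀ i, NormedAddCommGroup (X i)]
  [∀ i, NormedAddCommGroup (Y i)]

/-- `ω : ⊔ᵢ Uᵢ → ℝ` is an adjusting weight for the family `(rᵢ)ᵢ`, where `rᵢ ∈ ]0, ∞]`. -/
def IsAdjustingFor (U : ∀ i, Opens (X i)) (r : ι → ℝ≥0∞) (ω : (Σ i, U i) → ℝ) : Prop :=
  ∀ i, (⨆ x : U i, ‖ω ⟨i, x⟩‖ₑ) < ∞ ∧ max (r i)⁻¹ 1 ≤ ⨅ x : U i, ‖ω ⟨i, x⟩‖ₑ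

/-- `ω` is an adjusting weight for the family `(Vᵢ)ᵢ` of sets (star-shaped with center `0`):
it is adjusting for the distances of `0` to the boundaries of the `Vᵢ` (with `dist(0, ∅) = ∞`). -/
def IsAdjustingWeight (U : ∀ i, Opens (X i)) (V : ∀ i, Opens (Y i)) (ω : (Σ i, U i) → ℝ) : Prop :=
  IsAdjustingFor U (fun i => Metric.infEDist (0 : Y i) (frontier (V i : Set (Y i)))) ω

/-- The set of all `γ ∈ C^k_W(Uᵢ, Yᵢ)ᵢ` for which there is `r > 0` such that, for all `i` and all
`x ∈ Uᵢ`, the ball around `γᵢ(x)` with radius `r / |ω(x)|` is contained in `Vᵢ`. -/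
def omegaOpen (𝕂 : Type*) [RCLike 𝕂] [∀ i, NormedSpace 𝕂 (X i)] [∀ i, NormedSpace 𝕂 (Y i)]
    (U : ∀ i, Opens (X i)) (V : ∀ i, Opens (Y i)) (W : Set (Weight U)) (k : ℕ∞)
    (ω : (Σ i, U i) → ℝ) : Set (WProd 𝕂 U Y W k) :=
  {γ | ∃ r > 0, ∀ i, ∀ x : U i, Metric.ball (γ.toFam i x) (r / |ω ⟨i, x⟩|) ⊆ (V i : Set (Y i))}

end Adjusting

end WeightedProducts

end

open WeightedProducts

open WeightedProducts

/-! ### Mean value estimates with weights in `[0, ∞]` -/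

section MeanValue

variable {𝕂 : Type*} [RCLike 𝕂] {E F : Type*} [NormedAddCommGroup E] [NormedSpace 𝕂 E]
  [NormedAddCommGroup F] [NormedSpace 𝕂 F]

/-! Write `β_*` for the superposition operator. Everything follows from two uniform estimates in
each quasinorm: `β_*` is Lipschitz along admissible steps, and its first order Taylor remainder is
quadratic (`HasTaylorEstimate`). The linear term is superposition with `dirDeriv 𝕂 β`, applied to
the pair `(γ, η)`.

For order `0` this is the mean value inequality in the second variable. For order `ℓ + 1`, the
derivative of `x ↦ β i (x, γ i x)` is again a superposition: `jetMap 𝕂 β` applied to the jet `(γ,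
γ')`. Differentiation also turns the linear term of `β` into that of `jetMap 𝕂 β`, by symmetry of
second derivatives (`IsAdmissible.hasFDerivAt_superpos_dirDeriv`). Hence order `ℓ` for `jetMap 𝕂 β`
gives order `ℓ + 1` for `β` (`hasTaylorEstimate_succ`).

The induction needs a class of maps stable under `jetMap` and `dirDeriv`. Both are affine in a new,
unbounded variable, so bounds uniform on `V i` cannot persist; `IsAdmissible` asks for them only on
bounded sets. This suffices because `ω ∈ W` and `1 ≤ |ω|`, which makes elements of the weighted
product bounded together with their derivatives.

The weights `g` of the maximal extension are used only through `IsDominated`, obtained by testing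
continuity of the seminorm on scalar functions times unit vectors of `Y i`
(`IsExtWeight.isDominated`).

The conclusions: the Lipschitz estimate at `γ = 0` shows that `β_*` takes values in the weighted
product (`toFam_superposMap`), and near other points it gives continuity. The quadratic remainder
gives the directional derivatives. The differential is the superposition operator of the admissible
map `dirDeriv 𝕂 β` composed with the continuous linear map `pair`, so an induction gives `C^n` for
all `n` (`isCOn_superposMap`). -/

theorem norm_add_sub_le_of_norm_hasFDerivAt_le {φ : E → F} {φ' : E → E →L[𝕂] F} {y η : E} {C : ℝ}
    (hφ : ∀ t : ℝ, 0 ≤ t → t ≤ 1 → HasFDerivAt φ (φ' (y + (t : 𝕂) • η)) (y + (t : 𝕂) • η))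
    (hC : ∀ t : ℝ, 0 ≤ t → t ≤ 1 → ‖φ' (y + (t : 𝕂) • η)‖ ≤ C) :
    ‖φ (y + η) - φ y‖ ≤ C * ‖η‖ := by
  let : NormedSpace ℝ F := NormedSpace.restrictScalars ℝ 𝕂 F
  let : NormedSpace ℝ E := NormedSpace.restrictScalars ℝ 𝕂 E
  have : IsScalarTower ℝ 𝕂 F := RestrictScalars.isScalarTower ℝ 𝕂 F
  have : IsScalarTower ℝ 𝕂 E := RestrictScalars.isScalarTower ℝ 𝕂 E
  have h := norm_image_sub_le_of_norm_deriv_le_segment_01' (E := F)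
    (f := fun t : ℝ => φ (y + (t : 𝕂) • η)) (f' := fun t => φ' (y + (t : 𝕂) • η) η)
    (C := C * ‖η‖) ?_ ?_
  · simpa using h
  · intro t ht
    have h1 : HasDerivAt (fun t : ℝ => y + (t : 𝕂) • η) η t := by
      have : HasDerivAt (fun t : ℝ => y + t • η) ((1 : ℝ) • η) t :=
        ((hasDerivAt_id t).smul_const η).const_add y
      rw [one_smul] at this
      convert this using 3 with s
      exact algebraMap_smul 𝕂 s η
    exact (((hφ t ht.1 ht.2).restrictScalars ℝ).comp_hasDerivAt t h1).hasDerivWithinAt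
  · intro t ht
    exact (ContinuousLinearMap.le_opNorm _ _).trans
      (mul_le_mul_of_nonneg_right (hC t ht.1 ht.2.le) (norm_nonneg _))

/-- Divide the bound by the weight `a` and apply the mean value inequality. The weight `a = ∞` is
allowed: for finite `G` the quotient `G / a` is then `0`, so the derivative vanishes along the
segment and both sides are compatible with `∞ * 0 = 0`. -/
theorem mul_enorm_add_sub_le {φ : E → F} {φ' : E → E →L[𝕂] F} {y η : E} {a G : ℝ≥0∞}
    (hφ : ∀ t : ℝ, 0 ≤ t → t ≤ 1 → HasFDerivAt φ (φ' (y + (t : 𝕂) • η)) (y + (t : 𝕂) • η))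
    (hG : ∀ t : ℝ, 0 ≤ t → t ≤ 1 → a * ‖φ' (y + (t : 𝕂) • η)‖ₑ ≤ G) :
    a * ‖φ (y + η) - φ y‖ₑ ≤ G * ‖η‖ₑ := by
  rcases eq_or_ne η 0 with rfl | hη
  · simp
  rcases eq_or_ne a 0 with rfl | ha
  · simp
  rcases eq_or_ne G ∞ with rfl | hG'
  · rw [ENNReal.top_mul (by simpa using hη)]
    exact le_top
  have hfin : G / a ≠ ∞ := ENNReal.div_ne_top hG' ha
  have hb : ∀ t : ℝ, 0 ≤ t → t ≤ 1 → ‖φ' (y + (t : 𝕂) • η)‖ₑ ≤ G / a := fun t h0 h1 => by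
    rw [ENNReal.le_div_iff_mul_le (Or.inl ha) (Or.inr hG'), mul_comm]
    exact hG t h0 h1
  have h := norm_add_sub_le_of_norm_hasFDerivAt_le (C := (G / a).toReal) hφ fun t h0 h1 => by
    rw [← toReal_enorm]
    exact ENNReal.toReal_mono hfin (hb t h0 h1)
  have h' : ‖φ (y + η) - φ y‖ₑ ≤ G / a * ‖η‖ₑ := by
    rw [← ENNReal.toReal_le_toReal enorm_ne_top (ENNReal.mul_ne_top hfin enorm_ne_top),
      ENNReal.toReal_mul, toReal_enorm, toReal_enorm]
    exact h
  calc a * ‖φ (y + η) - φ y‖ₑ ≤ a * (G / a * ‖η‖ₑ) := mul_le_mul_right h' a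
    _ = a * (G / a) * ‖η‖ₑ := (mul_assoc _ _ _).symm
    _ ≤ G * ‖η‖ₑ := mul_le_mul_left ENNReal.mul_div_le _

/-- The mean value estimate is used twice: for `φ - φ' y`, and, to bound its derivative `φ' z - φ'
y`, for `φ'` on the initial pieces of the segment. -/
theorem mul_enorm_add_sub_sub_le {φ : E → F} {φ' : E → E →L[𝕂] F}
    {φ'' : E → E →L[𝕂] E →L[𝕂] F} {y η : E} {a G : ℝ≥0∞}
    (hφ : ∀ t : ℝ, 0 ≤ t → t ≤ 1 → HasFDerivAt φ (φ' (y + (t : 𝕂) • η)) (y + (t : 𝕂) • η))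
    (hφ' : ∀ t : ℝ, 0 ≤ t → t ≤ 1 → HasFDerivAt φ' (φ'' (y + (t : 𝕂) • η)) (y + (t : 𝕂) • η))
    (hG : ∀ t : ℝ, 0 ≤ t → t ≤ 1 → a * ‖φ'' (y + (t : 𝕂) • η)‖ₑ ≤ G) :
    a * ‖φ (y + η) - φ y - φ' y η‖ₑ ≤ G * ‖η‖ₑ * ‖η‖ₑ := by
  have key := mul_enorm_add_sub_le (𝕂 := 𝕂) (φ := fun z => φ z - φ' y z)
    (φ' := fun z => φ' z - φ' y) (y := y) (η := η) (a := a) (G := G * ‖η‖ₑ)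
    (fun t h0 h1 => (hφ t h0 h1).sub (φ' y).hasFDerivAt) ?_
  · convert key using 3
    simp only [map_add]
    abel
  · intro t h0 h1
    have hs : ∀ s : ℝ, (s : 𝕂) • (t : 𝕂) • η = ((s * t : ℝ) : 𝕂) • η := fun s => by
      rw [smul_smul]; push_cast; rfl
    have h2 := mul_enorm_add_sub_le (𝕂 := 𝕂) (φ := φ') (φ' := φ'') (y := y) (η := (t : 𝕂) • η)
      (a := a) (G := G)
      (fun s s0 s1 => by
        rw [hs]; exact hφ' _ (mul_nonneg s0 h0) (mul_le_one₀ s1 h0 h1))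
      (fun s s0 s1 => by
        rw [hs]; exact hG _ (mul_nonneg s0 h0) (mul_le_one₀ s1 h0 h1))
    refine h2.trans (mul_le_mul_right ?_ G)
    rw [enorm_smul]
    refine mul_le_of_le_one_left' ?_
    rw [← ofReal_norm, RCLike.norm_ofReal, abs_of_nonneg h0]
    simpa using h1

end MeanValue

/-! ### Derivatives of a bilinear expression in the derivative of a function -/

section Bilinear

variable {𝕂 : Type*} [RCLike 𝕂] {D E F G H : Type*} [NormedAddCommGroup D] [NormedSpace 𝕂 D]
  [NormedAddCommGroup E] [NormedSpace 𝕂 E] [NormedAddCommGroup F] [NormedSpace 𝕂 F]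
  [NormedAddCommGroup G] [NormedSpace 𝕂 G] [NormedAddCommGroup H] [NormedSpace 𝕂 H]

/-- A crude bound that serves all orders at once: order `0` contributes the value, order `1` the
linear part, and higher derivatives vanish. -/
theorem norm_iteratedFDeriv_const_add_clm_le (c : F) (A : D →L[𝕂] F) (hA : ‖A‖ ≤ 1) (n : ℕ)
    (p : D) : ‖iteratedFDeriv 𝕂 n (fun q => c + A q) p‖ ≤ ‖c‖ + 1 + ‖A p‖ := by
  have hc := norm_nonneg c
  have hp := norm_nonneg (A p)
  have hf : fderiv 𝕂 (fun q => c + A q) = fun _ => A := by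
    ext1 q
    exact (A.hasFDerivAt.const_add c).fderiv
  match n with
  | 0 =>
    rw [norm_iteratedFDeriv_zero]
    have h2 := norm_add_le c (A p)
    linarith
  | 1 =>
    rw [← norm_iteratedFDeriv_fderiv, hf, norm_iteratedFDeriv_zero]
    linarith
  | n + 2 =>
    rw [← norm_iteratedFDeriv_fderiv, hf, iteratedFDeriv_succ_const]
    simp only [Pi.zero_apply, norm_zero]
    positivity

/-- This is the Leibniz rule for the pairing `B`. Only derivatives of `β` of positive order occur,
since `β` enters through `fderiv 𝕂 β`; precomposition with the contraction `P` does not increase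
norms. -/
theorem norm_iteratedFDeriv_bilin_fderiv_le (B : (E →L[𝕂] G) →L[𝕂] F →L[𝕂] H) (hB : ‖B‖ ≤ 1)
    {β : E → G} {S : Set E} (hS : IsOpen S) (hβ : ContDiffOn 𝕂 (⊤ : ℕ∞) β S)
    (P : D →L[𝕂] E) (hP : ‖P‖ ≤ 1) (c : F) (A : D →L[𝕂] F) (hA : ‖A‖ ≤ 1) (n : ℕ) {p : D}
    (hp : P p ∈ S) :
    ‖iteratedFDeriv 𝕂 n (fun q => B (fderiv 𝕂 β (P q)) (c + A q)) p‖ ≤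
      ∑ i ∈ Finset.range (n + 1),
        n.choose i * ‖iteratedFDeriv 𝕂 (i + 1) β (P p)‖ * (‖c‖ + 1 + ‖A p‖) := by
  have hT : IsOpen (P ⁻¹' S) := hS.preimage P.continuous
  have hd : ContDiffOn 𝕂 (⊤ : ℕ∞) (fderiv 𝕂 β) S := hβ.fderiv_of_isOpen hS (by simp)
  have h1 : ContDiffOn 𝕂 (⊤ : ℕ∞) (fderiv 𝕂 β ∘ P) (P ⁻¹' S) :=
    hd.comp P.contDiff.contDiffOn (fun _ h => h)
  have h2 : ContDiffOn 𝕂 (⊤ : ℕ∞) (fun q => c + A q) (P ⁻¹' S) :=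
    (contDiff_const.add A.contDiff).contDiffOn
  have h := B.norm_iteratedFDerivWithin_le_of_bilinear_of_le_one h1 h2 hT.uniqueDiffOn
    (x := p) hp (n := n) (by exact_mod_cast le_top) hB
  rw [iteratedFDerivWithin_of_isOpen n hT hp] at h
  refine h.trans (Finset.sum_le_sum fun i _ => ?_)
  rw [iteratedFDerivWithin_of_isOpen (n - i) hT hp]
  refine mul_le_mul (mul_le_mul_of_nonneg_left ?_ (Nat.cast_nonneg _))
    (norm_iteratedFDeriv_const_add_clm_le c A hA _ p) (norm_nonneg _) (by positivity)
  rw [P.iteratedFDerivWithin_comp_right hd hS.uniqueDiffOn hT.uniqueDiffOn hp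
    (by exact_mod_cast le_top), iteratedFDerivWithin_of_isOpen _ hS hp]
  refine (ContinuousMultilinearMap.norm_compContinuousLinearMap_le _ _).trans ?_
  rw [norm_iteratedFDeriv_fderiv]
  refine mul_le_of_le_one_right (norm_nonneg _) ?_
  exact Finset.prod_le_one (fun _ _ => norm_nonneg _) (fun _ _ => hP)

end Bilinear

/-! ### Weighted quasinorms of families of functions -/

section Families

open scoped NNReal

/-- Weights with values in `[0, ∞]`. -/
abbrev EWeight {ι : Type*} {X : ι → Type*} [∀ i, TopologicalSpace (X i)]
    (U : ∀ i, Opens (X i)) : Type _ := (Σ i, U i) → ℝ≥0∞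

variable (𝕂 : Type*) [RCLike 𝕂] {ι : Type*} {X : ι → Type*} [∀ i, NormedAddCommGroup (X i)]
  [∀ i, NormedSpace 𝕂 (X i)] {U : ∀ i, Opens (X i)}
  {Y : ι → Type*} [∀ i, NormedAddCommGroup (Y i)] [∀ i, NormedSpace 𝕂 (Y i)]
  {Z : ι → Type*} [∀ i, NormedAddCommGroup (Z i)] [∀ i, NormedSpace 𝕂 (Z i)]

/-- The quasinorm of order `ℓ` with weight `F` of a family of functions `φ i : X i → Y i`, of which
only the restrictions to the sets `U i` matter. -/
noncomputable def wNorm (F : EWeight U) (ℓ : ℕ) (φ : ∀ i, X i → Y i) : ℝ≥0∞ :=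
  ⨆ p : Σ i, U i, F p * ‖iteratedFDeriv 𝕂 ℓ (φ p.1) (p.2 : X p.1)‖ₑ

variable {𝕂}

theorem enorm_iteratedFDeriv_zero {E F : Type*} [NormedAddCommGroup E] [NormedSpace 𝕂 E]
    [NormedAddCommGroup F] [NormedSpace 𝕂 F] (f : E → F) (x : E) :
    ‖iteratedFDeriv 𝕂 0 f x‖ₑ = ‖f x‖ₑ := by
  rw [← ofReal_norm, norm_iteratedFDeriv_zero, ofReal_norm]

theorem enorm_iteratedFDeriv_fderiv {E F : Type*} [NormedAddCommGroup E] [NormedSpace 𝕂 E]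
    [NormedAddCommGroup F] [NormedSpace 𝕂 F] (f : E → F) (x : E) (n : ℕ) :
    ‖iteratedFDeriv 𝕂 n (fderiv 𝕂 f) x‖ₑ = ‖iteratedFDeriv 𝕂 (n + 1) f x‖ₑ := by
  rw [← ofReal_norm, norm_iteratedFDeriv_fderiv, ofReal_norm]

theorem enorm_fderiv_fderiv_eq {E F : Type*} [NormedAddCommGroup E] [NormedSpace 𝕂 E]
    [NormedAddCommGroup F] [NormedSpace 𝕂 F] (f : E → F) (x : E) :
    ‖fderiv 𝕂 (fderiv 𝕂 f) x‖ₑ = ‖iteratedFDeriv 𝕂 2 f x‖ₑ := by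
  rw [← enorm_iteratedFDeriv_fderiv, ← enorm_iteratedFDeriv_fderiv, enorm_iteratedFDeriv_zero]

theorem wNorm_zero (F : EWeight U) (φ : ∀ i, X i → Y i) :
    wNorm 𝕂 F 0 φ = ⨆ p : Σ i, U i, F p * ‖φ p.1 p.2‖ₑ := by
  simp only [wNorm, enorm_iteratedFDeriv_zero]

theorem wNorm_succ (F : EWeight U) (ℓ : ℕ) (φ : ∀ i, X i → Y i) :
    wNorm 𝕂 F (ℓ + 1) φ = wNorm 𝕂 F ℓ fun i => fderiv 𝕂 (φ i) := by
  simp only [wNorm, enorm_iteratedFDeriv_fderiv]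

theorem wNorm_congr (F : EWeight U) (ℓ : ℕ) {φ ψ : ∀ i, X i → Y i}
    (h : ∀ i, ∀ x ∈ U i, φ i x = ψ i x) : wNorm 𝕂 F ℓ φ = wNorm 𝕂 F ℓ ψ := by
  unfold wNorm
  congr 1 with p
  have : φ p.1 =ᶠ[𝓝 (p.2 : X p.1)] ψ p.1 :=
    Filter.eventually_of_mem ((U p.1).isOpen.mem_nhds p.2.2) (h p.1)
  rw [(this.iteratedFDeriv 𝕂 ℓ).eq_of_nhds]

theorem le_wNorm_zero (F : EWeight U) (φ : ∀ i, X i → Y i) {i : ι} {x : X i} (hx : x ∈ U i) :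
    F ⟨i, x, hx⟩ * ‖φ i x‖ₑ ≤ wNorm 𝕂 F 0 φ := by
  rw [wNorm_zero]
  exact le_iSup (fun p : Σ i, U i => F p * ‖φ p.1 p.2‖ₑ) ⟨i, x, hx⟩

theorem enorm_le_wNorm_zero {w : EWeight U} (hw : ∀ p, 1 ≤ w p) (φ : ∀ i, X i → Y i) {i : ι}
    {x : X i} (hx : x ∈ U i) : ‖φ i x‖ₑ ≤ wNorm 𝕂 w 0 φ :=
  (le_mul_of_one_le_left' (hw _)).trans (le_wNorm_zero w φ hx)

/-- The family of maps `x ↦ (γ i x, η i x)`. -/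
def famPair (γ : ∀ i, X i → Y i) (η : ∀ i, X i → Z i) : ∀ i, X i → Y i × Z i :=
  fun i x => (γ i x, η i x)

variable (𝕂) in
/-- The family of maps `x ↦ (γ i x, γ i'(x))`. -/
noncomputable def famJet (γ : ∀ i, X i → Y i) : ∀ i, X i → Y i × (X i →L[𝕂] Y i) :=
  famPair γ fun i => fderiv 𝕂 (γ i)

theorem wNorm_famPair_le (F : EWeight U) (ℓ : ℕ) {γ : ∀ i, X i → Y i} {η : ∀ i, X i → Z i}
    (hγ : ∀ i, ContDiffOn 𝕂 ℓ (γ i) (U i)) (hη : ∀ i, ContDiffOn 𝕂 ℓ (η i) (U i)) :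
    wNorm 𝕂 F ℓ (famPair γ η) ≤ max (wNorm 𝕂 F ℓ γ) (wNorm 𝕂 F ℓ η) := by
  refine iSup_le fun p => ?_
  have hp := (U p.1).isOpen.mem_nhds p.2.2
  have h1 : ‖iteratedFDeriv 𝕂 ℓ (famPair γ η p.1) (p.2 : X p.1)‖ₑ =
      max ‖iteratedFDeriv 𝕂 ℓ (γ p.1) (p.2 : X p.1)‖ₑ
        ‖iteratedFDeriv 𝕂 ℓ (η p.1) (p.2 : X p.1)‖ₑ := by
    unfold famPair
    rw [iteratedFDeriv_prodMk ((hγ p.1).contDiffAt hp) ((hη p.1).contDiffAt hp) le_rfl,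
      ← ofReal_norm, ContinuousMultilinearMap.opNorm_prod, ENNReal.ofReal_max, ofReal_norm,
      ofReal_norm]
  rw [h1, mul_max]
  exact max_le_max
    (le_iSup (fun p : Σ i, U i => F p * ‖iteratedFDeriv 𝕂 ℓ (γ p.1) (p.2 : X p.1)‖ₑ) p)
    (le_iSup (fun p : Σ i, U i => F p * ‖iteratedFDeriv 𝕂 ℓ (η p.1) (p.2 : X p.1)‖ₑ) p)

/-! ### Weights dominated by a set of weights -/

/-- The weighted supremum of a scalar function. -/
noncomputable def wSup (F : EWeight U) (u : (Σ i, U i) → ℝ) : ℝ≥0∞ := ⨆ p, F p * ‖u p‖ₑ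

theorem le_wSup (F : EWeight U) (u : (Σ i, U i) → ℝ) (p : Σ i, U i) :
    F p * ‖u p‖ₑ ≤ wSup F u := le_iSup (fun p => F p * ‖u p‖ₑ) p

/-- The weight `G` is dominated by the set of weights `W`: the weighted supremum for `G` of scalar
continuous functions is bounded by those for finitely many elements of `W`. -/
def IsDominated (W : Set (EWeight U)) (G : EWeight U) : Prop :=
  ∃ s : Finset (EWeight U), (s : Set (EWeight U)) ⊆ W ∧ ∃ C : ℝ≥0, ∀ u : (Σ i, U i) → ℝ,
    Continuous u → (∀ f ∈ W, wSup f u < ∞) → wSup G u ≤ C * ∑ f ∈ s, wSup f u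

theorem IsDominated.zero (W : Set (EWeight U)) : IsDominated W (0 : EWeight U) :=
  ⟨∅, by simp, 0, fun u _ _ => by simp [wSup]⟩

theorem IsDominated.add {W : Set (EWeight U)} {G H : EWeight U} (hG : IsDominated W G)
    (hH : IsDominated W H) : IsDominated W (G + H) := by
  classical
  obtain ⟨s, hs, C, hC⟩ := hG
  obtain ⟨t, ht, D, hD⟩ := hH
  refine ⟨s ∪ t, by simp [hs, ht], C + D, fun u hu hf => ?_⟩
  have h1 := (hC u hu hf).trans (mul_le_mul_right (Finset.sum_le_sum_of_subset
    (f := fun f => wSup f u) (Finset.subset_union_left (s₂ := t))) _)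
  have h2 := (hD u hu hf).trans (mul_le_mul_right (Finset.sum_le_sum_of_subset
    (f := fun f => wSup f u) (Finset.subset_union_right (s₁ := s))) _)
  rw [ENNReal.coe_add, add_mul]
  refine le_trans (iSup_le fun p => ?_) (add_le_add h1 h2)
  rw [Pi.add_apply, add_mul]
  exact add_le_add (le_wSup G u p) (le_wSup H u p)

theorem IsDominated.const_mul {W : Set (EWeight U)} {G : EWeight U} (hG : IsDominated W G)
    (c : ℝ≥0) : IsDominated W fun p => c * G p := by
  obtain ⟨s, hs, C, hC⟩ := hG
  refine ⟨s, hs, c * C, fun u hu hf => iSup_le fun p => ?_⟩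
  rw [ENNReal.coe_mul, mul_assoc, mul_assoc]
  exact mul_le_mul_right ((le_wSup G u p).trans (hC u hu hf)) _

theorem IsDominated.sum {W : Set (EWeight U)} {κ : Type*} (t : Finset κ) {G : κ → EWeight U}
    (hG : ∀ j ∈ t, IsDominated W (G j)) : IsDominated W (∑ j ∈ t, G j) :=
  Finset.sum_induction _ (IsDominated W) (fun _ _ => IsDominated.add) (IsDominated.zero W) hG

/-! ### Families of maps with locally dominated derivatives -/

/-- The family of maps `x ↦ β i (x, γ i x)`. -/
def superpos (β : ∀ i, X i × Y i → Z i) (γ : ∀ i, X i → Y i) : ∀ i, X i → Z i :=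
  fun i x => β i (x, γ i x)

variable (𝕂) in
/-- The directional derivative of `β i` in the second variable. -/
noncomputable def dirDeriv (β : ∀ i, X i × Y i → Z i) : ∀ i, X i × (Y i × Y i) → Z i :=
  fun i p => fderiv 𝕂 (β i) (p.1, p.2.1) (0, p.2.2)

variable (𝕂) in
/-- The map `(x, y, A) ↦ β i'(x, y) ∘ (id, A)`, which describes the derivatives of the maps
`x ↦ β i (x, γ i x)`. -/
noncomputable def jetMap (β : ∀ i, X i × Y i → Z i) :
    ∀ i, X i × (Y i × (X i →L[𝕂] Y i)) → (X i →L[𝕂] Z i) :=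
  fun i p => (fderiv 𝕂 (β i) (p.1, p.2.1)).comp ((ContinuousLinearMap.id 𝕂 (X i)).prod p.2.2)

variable (𝕂) in
/-- The maps `β i` are smooth on `U i × V i`, vanish on `U i × {0}`, and their derivatives of
positive orders are dominated by the weights in `W`, locally uniformly in the second variable. -/
structure IsAdmissible (W : Set (EWeight U)) (V : ∀ i, Set (Y i)) (β : ∀ i, X i × Y i → Z i) :
    Prop where
  isOpen : ∀ i, IsOpen (V i)
  zero_mem : ∀ i, (0 : Y i) ∈ V i
  starShaped : ∀ i, StarShaped 𝕂 (V i)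
  contDiffOn : ∀ i, ContDiffOn 𝕂 (⊤ : ℕ∞) (β i) ((U i : Set (X i)) ×ˢ V i)
  map_zero : ∀ i, ∀ x ∈ U i, β i (x, 0) = 0
  bound : ∀ f ∈ W, ∀ ℓ : ℕ, 1 ≤ ℓ → ∀ R : ℝ≥0, ∃ G, IsDominated W G ∧
    ∀ i, ∀ x (hx : x ∈ U i), ∀ y ∈ V i, ‖y‖ₑ ≤ R →
      f ⟨i, x, hx⟩ * ‖iteratedFDeriv 𝕂 ℓ (β i) (x, y)‖ₑ ≤ G ⟨i, x, hx⟩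

variable {W : Set (EWeight U)} {V : ∀ i, Set (Y i)} {β : ∀ i, X i × Y i → Z i}

theorem IsAdmissible.isOpen_prod (h : IsAdmissible 𝕂 W V β) (i : ι) :
    IsOpen ((U i : Set (X i)) ×ˢ V i) := (U i).isOpen.prod (h.isOpen i)

theorem IsAdmissible.contDiffAt (h : IsAdmissible 𝕂 W V β) {i : ι} {x : X i} (hx : x ∈ U i)
    {y : Y i} (hy : y ∈ V i) : ContDiffAt 𝕂 (⊤ : ℕ∞) (β i) (x, y) :=
  (h.contDiffOn i).contDiffAt ((h.isOpen_prod i).mem_nhds ⟨hx, hy⟩)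

theorem IsAdmissible.hasFDerivAt (h : IsAdmissible 𝕂 W V β) {i : ι} {x : X i} (hx : x ∈ U i)
    {y : Y i} (hy : y ∈ V i) : HasFDerivAt (β i) (fderiv 𝕂 (β i) (x, y)) (x, y) :=
  ((h.contDiffAt hx hy).differentiableAt (by simp)).hasFDerivAt

theorem IsAdmissible.hasFDerivAt_fderiv (h : IsAdmissible 𝕂 W V β) {i : ι} {x : X i}
    (hx : x ∈ U i) {y : Y i} (hy : y ∈ V i) :
    HasFDerivAt (fderiv 𝕂 (β i)) (fderiv 𝕂 (fderiv 𝕂 (β i)) (x, y)) (x, y) :=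
  (((h.contDiffAt hx hy).fderiv_right (m := (⊤ : ℕ∞)) (by simp)).differentiableAt
    (by simp)).hasFDerivAt

theorem starShaped_prod_univ {E F : Type*} [NormedAddCommGroup E] [NormedSpace 𝕂 E]
    [NormedAddCommGroup F] [NormedSpace 𝕂 F] {S : Set E} (hS : StarShaped 𝕂 S) :
    StarShaped 𝕂 (S ×ˢ (univ : Set F)) :=
  fun y hy t h0 h1 => ⟨hS y.1 hy.1 t h0 h1, mem_univ _⟩

/-- Maps which are bilinear in the derivative of `β i` and an additional variable inherit the
bounds on the derivatives. -/
theorem IsAdmissible.bound_bilin (h : IsAdmissible 𝕂 W V β)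
    {E F H : ι → Type*} [∀ i, NormedAddCommGroup (E i)] [∀ i, NormedSpace 𝕂 (E i)]
    [∀ i, NormedAddCommGroup (F i)] [∀ i, NormedSpace 𝕂 (F i)]
    [∀ i, NormedAddCommGroup (H i)] [∀ i, NormedSpace 𝕂 (H i)]
    (B : ∀ i, ((X i × Y i) →L[𝕂] Z i) →L[𝕂] F i →L[𝕂] H i) (hB : ∀ i, ‖B i‖ ≤ 1)
    (c : ∀ i, F i) (hc : ∀ i, ‖c i‖ ≤ 1) (A : ∀ i, E i →L[𝕂] F i) (hA : ∀ i, ‖A i‖ ≤ 1)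
    {f : EWeight U} (hf : f ∈ W) (ℓ : ℕ) (R : ℝ≥0) : ∃ G, IsDominated W G ∧
    ∀ i, ∀ x (hx : x ∈ U i), ∀ y ∈ V i ×ˢ (univ : Set (E i)), ‖y‖ₑ ≤ R →
      f ⟨i, x, hx⟩ * ‖iteratedFDeriv 𝕂 ℓ (fun q : X i × (Y i × E i) =>
        B i (fderiv 𝕂 (β i) (q.1, q.2.1)) (c i + A i q.2.2)) (x, y)‖ₑ ≤ G ⟨i, x, hx⟩ := by
  choose G hG hGb using fun j : ℕ => h.bound f hf (j + 1) (by omega) R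
  -- In the factor `1 + 1 + R` the summands bound `‖c i‖`, `‖A i‖` and the value of `A i` at a point
  -- of norm at most `R`. The last one is why the bound is only locally uniform in `y`.
  refine ⟨∑ j ∈ Finset.range (ℓ + 1), fun p => ((ℓ.choose j * (1 + 1 + R) : ℝ≥0) : ℝ≥0∞) * G j p,
    IsDominated.sum _ fun j _ => (hG j).const_mul _, fun i x hx y hy hyR => ?_⟩
  have hy1 : ‖y.1‖ₑ ≤ R := (enorm_le_iff_norm_le.2 (norm_fst_le y)).trans hyR
  have hy2 : ‖y.2‖ₑ ≤ R := (enorm_le_iff_norm_le.2 (norm_snd_le y)).trans hyR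
  let P : X i × (Y i × E i) →L[𝕂] X i × Y i :=
    (ContinuousLinearMap.fst 𝕂 _ _).prod
      ((ContinuousLinearMap.fst 𝕂 _ _).comp (ContinuousLinearMap.snd 𝕂 _ _))
  let A' : X i × (Y i × E i) →L[𝕂] F i :=
    (A i).comp ((ContinuousLinearMap.snd 𝕂 _ _).comp (ContinuousLinearMap.snd 𝕂 _ _))
  have hP : ‖P‖ ≤ 1 := ContinuousLinearMap.opNorm_le_bound _ zero_le_one fun q => by
    rw [one_mul]
    exact max_le (norm_fst_le q) ((norm_fst_le q.2).trans (norm_snd_le q))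
  have hA' : ‖A'‖ ≤ 1 := ContinuousLinearMap.opNorm_le_bound _ zero_le_one fun q => by
    rw [one_mul]
    exact ((A i).le_of_opNorm_le (hA i) _).trans (by
      rw [one_mul]; exact (norm_snd_le q.2).trans (norm_snd_le q))
  have h1 := norm_iteratedFDeriv_bilin_fderiv_le (B i) (hB i) (h.isOpen_prod i) (h.contDiffOn i)
    P hP (c i) A' hA' ℓ (p := (x, y)) ⟨hx, hy.1⟩
  have h2 : ‖iteratedFDeriv 𝕂 ℓ (fun q : X i × (Y i × E i) =>
      B i (fderiv 𝕂 (β i) (q.1, q.2.1)) (c i + A i q.2.2)) (x, y)‖ₑ ≤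
      ∑ j ∈ Finset.range (ℓ + 1), ((ℓ.choose j * (1 + 1 + R) : ℝ≥0) : ℝ≥0∞) *
        ‖iteratedFDeriv 𝕂 (j + 1) (β i) (x, y.1)‖ₑ := by
    have hr : ‖A' (x, y)‖ ≤ R := by
      refine ((A i).le_of_opNorm_le (hA i) y.2).trans ?_
      rw [one_mul]
      exact_mod_cast hy2
    simp only [enorm, ← ENNReal.coe_mul, ← ENNReal.ofNNReal_finsetSum, ENNReal.coe_le_coe]
    rw [← NNReal.coe_le_coe]
    push_cast
    refine h1.trans (Finset.sum_le_sum fun j _ => ?_)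
    rw [mul_right_comm]
    gcongr
    · exact hc i
    · exact le_rfl
  refine (mul_le_mul_right h2 _).trans ?_
  rw [Finset.mul_sum, Finset.sum_apply]
  refine Finset.sum_le_sum fun j _ => ?_
  rw [mul_left_comm]
  exact mul_le_mul_right (hGb j i x hx y.1 hy.1 hy1) _

end Families

/-! ### Stability of admissible maps under directional derivatives and jets -/

section Admissible

open scoped NNReal

variable {𝕂 : Type*} [RCLike 𝕂] {ι : Type*} {X : ι → Type*} [∀ i, NormedAddCommGroup (X i)]
  [∀ i, NormedSpace 𝕂 (X i)] {U : ∀ i, Opens (X i)}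
  {Y : ι → Type*} [∀ i, NormedAddCommGroup (Y i)] [∀ i, NormedSpace 𝕂 (Y i)]
  {Z : ι → Type*} [∀ i, NormedAddCommGroup (Z i)] [∀ i, NormedSpace 𝕂 (Z i)]
  {W : Set (EWeight U)} {V : ∀ i, Set (Y i)} {β : ∀ i, X i × Y i → Z i}

theorem IsAdmissible.contDiffOn_fderiv (h : IsAdmissible 𝕂 W V β) (E : ι → Type*)
    [∀ i, NormedAddCommGroup (E i)] [∀ i, NormedSpace 𝕂 (E i)] (i : ι) :
    ContDiffOn 𝕂 (⊤ : ℕ∞) (fun q : X i × (Y i × E i) => fderiv 𝕂 (β i) (q.1, q.2.1))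
      ((U i : Set (X i)) ×ˢ (V i ×ˢ (univ : Set (E i)))) :=
  ((h.contDiffOn i).fderiv_of_isOpen (h.isOpen_prod i) (by simp)).comp
    (contDiff_fst.prodMk (contDiff_fst.comp contDiff_snd)).contDiffOn
    fun _ hq => ⟨hq.1, hq.2.1⟩

/-- The directional derivative pairs `fderiv 𝕂 (β i)` with the vector `(0, z)`, linear in the new
variable `z`; so `bound_bilin` applies with `c = 0`. -/
theorem isAdmissible_dirDeriv (h : IsAdmissible 𝕂 W V β) :
    IsAdmissible 𝕂 W (fun i => V i ×ˢ (univ : Set (Y i))) (dirDeriv 𝕂 β) where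
  isOpen i := (h.isOpen i).prod isOpen_univ
  zero_mem i := ⟨h.zero_mem i, mem_univ _⟩
  starShaped i := starShaped_prod_univ (h.starShaped i)
  contDiffOn i := (h.contDiffOn_fderiv Y i).clm_apply
    (contDiff_const.prodMk (contDiff_snd.comp contDiff_snd)).contDiffOn
  map_zero i x _ := (fderiv 𝕂 (β i) (x, 0)).map_zero
  bound f hf ℓ _ R := by
    obtain ⟨G, hG, hb⟩ := h.bound_bilin (E := Y) (F := fun i => X i × Y i)
      (fun i => ContinuousLinearMap.id 𝕂 (X i × Y i →L[𝕂] Z i))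
      (fun _ => ContinuousLinearMap.norm_id_le) 0 (by simp)
      (fun i => ContinuousLinearMap.inr 𝕂 (X i) (Y i))
      (fun i => ContinuousLinearMap.norm_inr_le_one 𝕂 (X i) (Y i)) hf ℓ R
    refine ⟨G, hG, fun i x hx y hy hyR => ?_⟩
    have := hb i x hx y hy hyR
    simp only [Pi.zero_apply, zero_add, ContinuousLinearMap.inr_apply] at this
    exact this

/-- Differentiate `β i (x, 0) = 0` along `U i`. This is what makes the jet map vanish at `(x, 0,
0)`. -/
theorem IsAdmissible.fderiv_apply_zero (h : IsAdmissible 𝕂 W V β) {i : ι} {x : X i} (hx : x ∈ U i)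
    (v : X i) : fderiv 𝕂 (β i) (x, 0) (v, 0) = 0 := by
  have h1 : HasFDerivAt (fun z : X i => (z, (0 : Y i))) (ContinuousLinearMap.inl 𝕂 (X i) (Y i)) x :=
    hasFDerivAt_prodMk_left x 0
  have h2 := (h.hasFDerivAt hx (h.zero_mem i)).comp x h1
  have h3 : HasFDerivAt (β i ∘ fun z : X i => (z, (0 : Y i))) (0 : X i →L[𝕂] Z i) x :=
    (hasFDerivAt_const (0 : Z i) x).congr_of_eventuallyEq
      (Filter.eventually_of_mem ((U i).isOpen.mem_nhds hx) fun z hz => h.map_zero i z hz)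
  simpa using congrArg (fun A : X i →L[𝕂] Z i => A v) (h2.unique h3)

/-- Since `(id, A) = inl + inr ∘ A`, the jet map is a composition pairing of `fderiv 𝕂 (β i)` with
an affine function of `A`, the shape required by `bound_bilin`. -/
theorem jetMap_eq (β : ∀ i, X i × Y i → Z i) (i : ι) :
    jetMap 𝕂 β i = fun q => ContinuousLinearMap.compL 𝕂 (X i) (X i × Y i) (Z i)
      (fderiv 𝕂 (β i) (q.1, q.2.1)) (ContinuousLinearMap.inl 𝕂 (X i) (Y i) +
        ContinuousLinearMap.compL 𝕂 (X i) (Y i) (X i × Y i)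
          (ContinuousLinearMap.inr 𝕂 (X i) (Y i)) q.2.2) := by
  ext q v
  simp [jetMap, ← map_add]

theorem isAdmissible_jetMap (h : IsAdmissible 𝕂 W V β) :
    IsAdmissible 𝕂 W (fun i => V i ×ˢ (univ : Set (X i →L[𝕂] Y i))) (jetMap 𝕂 β) where
  isOpen i := (h.isOpen i).prod isOpen_univ
  zero_mem i := ⟨h.zero_mem i, mem_univ _⟩
  starShaped i := starShaped_prod_univ (h.starShaped i)
  contDiffOn i := by
    rw [jetMap_eq]
    exact (((ContinuousLinearMap.contDiff _).comp_contDiffOn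
      (h.contDiffOn_fderiv (fun i => X i →L[𝕂] Y i) i))).clm_apply
      (contDiff_const.add ((ContinuousLinearMap.contDiff _).comp
        (contDiff_snd.comp contDiff_snd))).contDiffOn
  map_zero i x hx := by
    ext v
    simpa [jetMap] using h.fderiv_apply_zero hx v
  bound f hf ℓ _ R := by
    obtain ⟨G, hG, hb⟩ := h.bound_bilin (E := fun i => X i →L[𝕂] Y i)
      (F := fun i => X i →L[𝕂] X i × Y i) (H := fun i => X i →L[𝕂] Z i)
      (fun i => ContinuousLinearMap.compL 𝕂 (X i) (X i × Y i) (Z i))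
      (fun i => ContinuousLinearMap.norm_compL_le 𝕂 (X i) (X i × Y i) (Z i))
      (fun i => ContinuousLinearMap.inl 𝕂 (X i) (Y i))
      (fun i => ContinuousLinearMap.norm_inl_le_one 𝕂 (X i) (Y i))
      (fun i => ContinuousLinearMap.compL 𝕂 (X i) (Y i) (X i × Y i)
          (ContinuousLinearMap.inr 𝕂 (X i) (Y i)))
      (fun i => (ContinuousLinearMap.le_of_opNorm_le _
        (ContinuousLinearMap.norm_compL_le 𝕂 (X i) (Y i) (X i × Y i)) _).trans (by
          rw [one_mul]; exact ContinuousLinearMap.norm_inr_le_one 𝕂 (X i) (Y i))) hf ℓ R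
    refine ⟨G, hG, fun i x hx y hy hyR => ?_⟩
    rw [jetMap_eq]
    exact hb i x hx y hy hyR

end Admissible

/-! ### Derivatives of superpositions -/

section Superposition

variable {𝕂 : Type*} [RCLike 𝕂] {ι : Type*} {X : ι → Type*} [∀ i, NormedAddCommGroup (X i)]
  [∀ i, NormedSpace 𝕂 (X i)] {U : ∀ i, Opens (X i)}
  {Y : ι → Type*} [∀ i, NormedAddCommGroup (Y i)] [∀ i, NormedSpace 𝕂 (Y i)]
  {Z : ι → Type*} [∀ i, NormedAddCommGroup (Z i)] [∀ i, NormedSpace 𝕂 (Z i)]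
  {W : Set (EWeight U)} {V : ∀ i, Set (Y i)} {β : ∀ i, X i × Y i → Z i}
  {γ η : ∀ i, X i → Y i}

theorem IsAdmissible.contDiffOn_superpos (h : IsAdmissible 𝕂 W V β) {i : ι} {n : ℕ∞}
    (hγ : ContDiffOn 𝕂 n (γ i) (U i)) (hγV : ∀ x ∈ U i, γ i x ∈ V i) :
    ContDiffOn 𝕂 n (superpos β γ i) (U i) :=
  ((h.contDiffOn i).of_le (by exact_mod_cast le_top)).comp (contDiffOn_id.prodMk hγ)
    fun x hx => ⟨hx, hγV x hx⟩

theorem IsAdmissible.hasFDerivAt_superpos (h : IsAdmissible 𝕂 W V β) {i : ι} {x : X i}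
    (hx : x ∈ U i) (hγ : DifferentiableAt 𝕂 (γ i) x) (hγV : γ i x ∈ V i) :
    HasFDerivAt (superpos β γ i) (superpos (jetMap 𝕂 β) (famJet 𝕂 γ) i x) x :=
  (h.hasFDerivAt hx hγV).comp x ((hasFDerivAt_id x).prodMk hγ.hasFDerivAt)

/-- The product rule for the composition in `jetMap`: one term differentiates `fderiv 𝕂 (β i)`, the
other the factor `(id, A)`. -/
theorem IsAdmissible.fderiv_jetMap_apply (h : IsAdmissible 𝕂 W V β) {i : ι} {x : X i}
    (hx : x ∈ U i) {y : Y i} (hy : y ∈ V i) (A : X i →L[𝕂] Y i) (z : Y i) (B : X i →L[𝕂] Y i)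
    (v : X i) : fderiv 𝕂 (jetMap 𝕂 β i) (x, y, A) (0, z, B) v =
      fderiv 𝕂 (fderiv 𝕂 (β i)) (x, y) (0, z) (v, A v) + fderiv 𝕂 (β i) (x, y) (0, B v) := by
  have h1 : HasFDerivAt (fun q : X i × (Y i × (X i →L[𝕂] Y i)) => (q.1, q.2.1)) _ (x, y, A) :=
    ((ContinuousLinearMap.fst 𝕂 (X i) (Y i × (X i →L[𝕂] Y i))).prod
      ((ContinuousLinearMap.fst 𝕂 (Y i) (X i →L[𝕂] Y i)).comp
        (ContinuousLinearMap.snd 𝕂 (X i) (Y i × (X i →L[𝕂] Y i))))).hasFDerivAt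
  have h2 : HasFDerivAt (fun q : X i × (Y i × (X i →L[𝕂] Y i)) =>
      ContinuousLinearMap.inl 𝕂 (X i) (Y i) + ContinuousLinearMap.compL 𝕂 (X i) (Y i) (X i × Y i)
        (ContinuousLinearMap.inr 𝕂 (X i) (Y i)) q.2.2) _ (x, y, A) :=
    ((ContinuousLinearMap.compL 𝕂 (X i) (Y i) (X i × Y i)
        (ContinuousLinearMap.inr 𝕂 (X i) (Y i))).comp
      ((ContinuousLinearMap.snd 𝕂 (Y i) (X i →L[𝕂] Y i)).comp
        (ContinuousLinearMap.snd 𝕂 (X i) (Y i × (X i →L[𝕂] Y i))))).hasFDerivAt.const_add _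
  have h3 := HasFDerivAt.clm_comp
    (HasFDerivAt.comp (x, y, A) (h.hasFDerivAt_fderiv hx hy) h1) h2
  rw [jetMap_eq]
  refine (congrArg (fun T => T (0, z, B) v) h3.fderiv).trans ?_
  simp [← map_add, add_comm]

/-- The derivative of the superposition with the directional derivative is the superposition of
the jets with the directional derivative: this is the symmetry of second derivatives. -/
theorem IsAdmissible.hasFDerivAt_superpos_dirDeriv (h : IsAdmissible 𝕂 W V β) {i : ι} {x : X i}
    (hx : x ∈ U i) (hγ : DifferentiableAt 𝕂 (γ i) x) (hη : DifferentiableAt 𝕂 (η i) x)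
    (hγV : γ i x ∈ V i) :
    HasFDerivAt (superpos (dirDeriv 𝕂 β) (famPair γ η) i)
      (superpos (dirDeriv 𝕂 (jetMap 𝕂 β)) (famPair (famJet 𝕂 γ) (famJet 𝕂 η)) i x) x := by
  have h2 := h.hasFDerivAt_fderiv hx hγV
  have hsymm : IsSymmSndFDerivAt 𝕂 (β i) (x, γ i x) :=
    (h.contDiffAt hx hγV).isSymmSndFDerivAt (by
      rw [minSmoothness_of_isRCLikeNormedField]
      exact WithTop.coe_le_coe.2 (le_top : (2 : ℕ∞) ≤ ⊤))
  have h3 : HasFDerivAt (superpos (dirDeriv 𝕂 β) (famPair γ η) i) _ x :=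
    (h2.comp x ((hasFDerivAt_id x).prodMk hγ.hasFDerivAt)).clm_apply
      ((hasFDerivAt_const (0 : X i) x).prodMk hη.hasFDerivAt)
  convert h3 using 1
  ext v
  have h4 := h.fderiv_jetMap_apply hx hγV (fderiv 𝕂 (γ i) x) (η i x) (fderiv 𝕂 (η i) x) v
  have h5 := hsymm (0, η i x) (v, fderiv 𝕂 (γ i) x v)
  simp only [superpos, famPair, famJet, dirDeriv] at h4 ⊢
  rw [h4, h5, add_comm]
  simp

end Superposition

/-! ### Taylor estimates for superpositions -/

section Estimates

open scoped NNReal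

variable {𝕂 : Type*} [RCLike 𝕂] {ι : Type*} {X : ι → Type*} [∀ i, NormedAddCommGroup (X i)]
  [∀ i, NormedSpace 𝕂 (X i)] {U : ∀ i, Opens (X i)}
  {Y : ι → Type*} [∀ i, NormedAddCommGroup (Y i)] [∀ i, NormedSpace 𝕂 (Y i)]
  {Z : ι → Type*} [∀ i, NormedAddCommGroup (Z i)] [∀ i, NormedSpace 𝕂 (Z i)]

variable (𝕂) in
/-- The family `γ + t η`, `0 ≤ t ≤ 1`, stays in the sets `V i`, both families are `C^ℓ`, their
derivatives are bounded by `R` with respect to the weight `w`, and the quasinorms of `η` are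
finite. -/
structure IsStep (W : Set (EWeight U)) (w : EWeight U) (V : ∀ i, Set (Y i)) (ℓ : ℕ) (R : ℝ≥0)
    (γ η : ∀ i, X i → Y i) : Prop where
  contDiffOn_left : ∀ i, ContDiffOn 𝕂 ℓ (γ i) (U i)
  contDiffOn_right : ∀ i, ContDiffOn 𝕂 ℓ (η i) (U i)
  finite : ∀ f ∈ W, ∀ m ≤ ℓ, wNorm 𝕂 f m η < ∞
  mem : ∀ i, ∀ x ∈ U i, ∀ t : ℝ, 0 ≤ t → t ≤ 1 → γ i x + (t : 𝕂) • η i x ∈ V i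
  bound_left : ∀ m ≤ ℓ, wNorm 𝕂 w m γ ≤ R
  bound_right : ∀ m ≤ ℓ, wNorm 𝕂 w m η ≤ R

variable (𝕂) in
/-- Estimates for the superposition in the quasinorms of order `ℓ`: it is locally Lipschitz, and
the remainder of its first order Taylor expansion is quadratic. -/
def HasTaylorEstimate (W : Set (EWeight U)) (w : EWeight U) (V : ∀ i, Set (Y i))
    (β : ∀ i, X i × Y i → Z i) (ℓ : ℕ) : Prop :=
  ∀ f ∈ W, ∀ R : ℝ≥0, ∃ s : Finset (EWeight U), (s : Set (EWeight U)) ⊆ W ∧ ∃ C : ℝ≥0,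
    ∀ γ η : ∀ i, X i → Y i, IsStep 𝕂 W w V ℓ R γ η →
      wNorm 𝕂 f ℓ (superpos β (γ + η) - superpos β γ) ≤
        C * ∑ f ∈ s, ∑ m ∈ Finset.range (ℓ + 1), wNorm 𝕂 f m η ∧
      wNorm 𝕂 f ℓ
          (superpos β (γ + η) - superpos β γ - superpos (dirDeriv 𝕂 β) (famPair γ η)) ≤
        C * (∑ f ∈ s, ∑ m ∈ Finset.range (ℓ + 1), wNorm 𝕂 f m η) *
          ∑ m ∈ Finset.range (ℓ + 1), wNorm 𝕂 w m η

variable {W : Set (EWeight U)} {w : EWeight U} {V : ∀ i, Set (Y i)}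
  {β : ∀ i, X i × Y i → Z i} {ℓ : ℕ} {R : ℝ≥0} {γ η : ∀ i, X i → Y i}

theorem IsStep.mem_left (h : IsStep 𝕂 W w V ℓ R γ η) {i : ι} {x : X i} (hx : x ∈ U i) :
    γ i x ∈ V i := by
  simpa using h.mem i x hx 0 le_rfl zero_le_one

theorem IsStep.mem_add (h : IsStep 𝕂 W w V ℓ R γ η) {i : ι} {x : X i} (hx : x ∈ U i) :
    γ i x + η i x ∈ V i := by
  simpa using h.mem i x hx 1 zero_le_one le_rfl

theorem IsStep.enorm_le (h : IsStep 𝕂 W w V ℓ R γ η) (hw : ∀ p, 1 ≤ w p) {i : ι} {x : X i}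
    (hx : x ∈ U i) {t : ℝ} (h0 : 0 ≤ t) (h1 : t ≤ 1) :
    ‖γ i x + (t : 𝕂) • η i x‖ₑ ≤ (R + R : ℝ≥0) := by
  have ht : ‖(t : 𝕂)‖ₑ ≤ 1 := by
    rw [← ofReal_norm, RCLike.norm_ofReal, abs_of_nonneg h0]
    simpa using h1
  refine (enorm_add_le _ _).trans ?_
  rw [ENNReal.coe_add, enorm_smul]
  exact add_le_add ((enorm_le_wNorm_zero hw γ hx).trans (h.bound_left 0 (Nat.zero_le _)))
    ((mul_le_of_le_one_left' ht).trans
      ((enorm_le_wNorm_zero hw η hx).trans (h.bound_right 0 (Nat.zero_le _))))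

theorem ContDiffOn.contDiffOn_fderiv_nat {E F : Type*} [NormedAddCommGroup E] [NormedSpace 𝕂 E]
    [NormedAddCommGroup F] [NormedSpace 𝕂 F] {f : E → F} {S : Opens E} {n : ℕ}
    (hf : ContDiffOn 𝕂 (n + 1 : ℕ) f S) : ContDiffOn 𝕂 n (fderiv 𝕂 f) S :=
  hf.fderiv_of_isOpen S.isOpen (by norm_cast)

theorem ContDiffOn.differentiableAt_of_opens {E F : Type*} [NormedAddCommGroup E]
    [NormedSpace 𝕂 E] [NormedAddCommGroup F] [NormedSpace 𝕂 F] {f : E → F} {S : Opens E} {n : ℕ}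
    (hf : ContDiffOn 𝕂 (n + 1 : ℕ) f S) {x : E} (hx : x ∈ S) : DifferentiableAt 𝕂 f x :=
  (hf.contDiffAt (S.isOpen.mem_nhds hx)).differentiableAt (by norm_cast)

theorem contDiffOn_famJet {γ : ∀ i, X i → Y i} {i : ι}
    (hγ : ContDiffOn 𝕂 (ℓ + 1 : ℕ) (γ i) (U i)) : ContDiffOn 𝕂 ℓ (famJet 𝕂 γ i) (U i) :=
  (hγ.of_le (by norm_cast; omega)).prodMk hγ.contDiffOn_fderiv_nat

theorem wNorm_famJet_le (F : EWeight U) (hγ : ∀ i, ContDiffOn 𝕂 (ℓ + 1 : ℕ) (γ i) (U i)) {m : ℕ}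
    (hm : m ≤ ℓ) : wNorm 𝕂 F m (famJet 𝕂 γ) ≤ max (wNorm 𝕂 F m γ) (wNorm 𝕂 F (m + 1) γ) := by
  rw [wNorm_succ]
  exact wNorm_famPair_le F m (fun i => (hγ i).of_le (by norm_cast; omega))
    fun i => (hγ i).contDiffOn_fderiv_nat.of_le (by norm_cast)

/-- One order of differentiability is traded for one extra variable. The derivative component is
unconstrained, so the segment condition is inherited from `V i`. -/
theorem IsStep.famJet (h : IsStep 𝕂 W w V (ℓ + 1) R γ η) :
    IsStep 𝕂 W w (fun i => V i ×ˢ (univ : Set (X i →L[𝕂] Y i))) ℓ R (famJet 𝕂 γ) (famJet 𝕂 η) where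
  contDiffOn_left i := contDiffOn_famJet (h.contDiffOn_left i)
  contDiffOn_right i := contDiffOn_famJet (h.contDiffOn_right i)
  finite f hf m hm := (wNorm_famJet_le f h.contDiffOn_right hm).trans_lt
    (max_lt (h.finite f hf m (by omega)) (h.finite f hf (m + 1) (by omega)))
  mem i x hx t h0 h1 := ⟨h.mem i x hx t h0 h1, mem_univ _⟩
  bound_left m hm := (wNorm_famJet_le w h.contDiffOn_left hm).trans
    (max_le (h.bound_left m (by omega)) (h.bound_left (m + 1) (by omega)))
  bound_right m hm := (wNorm_famJet_le w h.contDiffOn_right hm).trans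
    (max_le (h.bound_right m (by omega)) (h.bound_right (m + 1) (by omega)))

/-- Order `m` of the jet involves orders `m` and `m + 1` of `γ`, so each order of `γ` is counted at
most twice. -/
theorem sum_wNorm_famJet_le (F : EWeight U)
    (hγ : ∀ i, ContDiffOn 𝕂 (ℓ + 1 : ℕ) (γ i) (U i)) :
    ∑ m ∈ Finset.range (ℓ + 1), wNorm 𝕂 F m (famJet 𝕂 γ) ≤
      2 * ∑ m ∈ Finset.range (ℓ + 1 + 1), wNorm 𝕂 F m γ := by
  calc ∑ m ∈ Finset.range (ℓ + 1), wNorm 𝕂 F m (famJet 𝕂 γ)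
      ≤ ∑ m ∈ Finset.range (ℓ + 1), (wNorm 𝕂 F m γ + wNorm 𝕂 F (m + 1) γ) :=
        Finset.sum_le_sum fun m hm =>
          (wNorm_famJet_le F hγ (Nat.lt_succ_iff.1 (Finset.mem_range.1 hm))).trans
            (max_le_add_of_nonneg zero_le zero_le)
    _ ≤ 2 * ∑ m ∈ Finset.range (ℓ + 1 + 1), wNorm 𝕂 F m γ := by
        rw [Finset.sum_add_distrib, two_mul]
        refine add_le_add ?_ ?_
        · rw [Finset.sum_range_succ _ (ℓ + 1)]
          exact le_self_add
        · rw [Finset.sum_range_succ' _ (ℓ + 1)]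
          exact le_self_add

theorem wNorm_succ_of_hasFDerivAt (F : EWeight U) {φ : ∀ i, X i → Y i}
    {φ' : ∀ i, X i → X i →L[𝕂] Y i} (h : ∀ i, ∀ x ∈ U i, HasFDerivAt (φ i) (φ' i x) x) :
    wNorm 𝕂 F (ℓ + 1) φ = wNorm 𝕂 F ℓ φ' := by
  rw [wNorm_succ]
  exact wNorm_congr F ℓ fun i x hx => (h i x hx).fderiv

/-- For fixed `x`, apply the mean value estimates to `y ↦ β i (x, y)` on the segment from `γ i x` to
`γ i x + η i x`, which lies in `V i` and in the ball of radius `R + R`. -/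
theorem hasTaylorEstimate_zero (h : IsAdmissible 𝕂 W V β) (hw : ∀ p, 1 ≤ w p) :
    HasTaylorEstimate 𝕂 W w V β 0 := by
  intro f hf R
  obtain ⟨G₁, hG₁, hb₁⟩ := h.bound f hf 1 le_rfl (R + R)
  obtain ⟨G₂, hG₂, hb₂⟩ := h.bound f hf 2 one_le_two (R + R)
  -- The sum of the two weights lets one finite set `s` and one constant `C` serve both estimates.
  obtain ⟨s, hs, C, hC⟩ := hG₁.add hG₂
  refine ⟨s, hs, C, fun γ η hst => ?_⟩
  -- Domination is a statement about suprema of scalar functions, not a pointwise inequality of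
  -- weights; it is tested on the norm of the increment.
  let u : (Σ i, U i) → ℝ := fun p => ‖η p.1 p.2‖
  have hu : Continuous u := continuous_sigma fun i =>
    ((hst.contDiffOn_right i).continuousOn.comp_continuous continuous_subtype_val
      fun x => x.2).norm
  have hsup : ∀ f : EWeight U, wSup f u = wNorm 𝕂 f 0 η := fun f => by
    simp [wSup, wNorm_zero, u]
  have hC' := hC u hu fun f hf => by
    rw [hsup]
    exact hst.finite f hf 0 le_rfl
  simp only [hsup] at hC'
  simp only [zero_add, Finset.range_one, Finset.sum_singleton]
  have hphi : ∀ (i : ι) (x : X i), x ∈ U i → ∀ t : ℝ, 0 ≤ t → t ≤ 1 →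
      HasFDerivAt (fun y => β i (x, y)) ((fderiv 𝕂 (β i) (x, γ i x + (t : 𝕂) • η i x)).comp
        (ContinuousLinearMap.inr 𝕂 (X i) (Y i))) (γ i x + (t : 𝕂) • η i x) :=
    fun i x hx t h0 h1 =>
      (h.hasFDerivAt hx (hst.mem i x hx t h0 h1)).comp _ (hasFDerivAt_prodMk_right x _)
  have hphi' : ∀ (i : ι) (x : X i), x ∈ U i → ∀ t : ℝ, 0 ≤ t → t ≤ 1 →
      HasFDerivAt
        (fun y => (fderiv 𝕂 (β i) (x, y)).comp (ContinuousLinearMap.inr 𝕂 (X i) (Y i)))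
        (((ContinuousLinearMap.compL 𝕂 (Y i) (X i × Y i) (Z i)).flip
          (ContinuousLinearMap.inr 𝕂 (X i) (Y i))).comp
            ((fderiv 𝕂 (fderiv 𝕂 (β i)) (x, γ i x + (t : 𝕂) • η i x)).comp
              (ContinuousLinearMap.inr 𝕂 (X i) (Y i)))) (γ i x + (t : 𝕂) • η i x) :=
    fun i x hx t h0 h1 => ((ContinuousLinearMap.compL 𝕂 (Y i) (X i × Y i) (Z i)).flip
      (ContinuousLinearMap.inr 𝕂 (X i) (Y i))).hasFDerivAt.comp _
      ((h.hasFDerivAt_fderiv hx (hst.mem i x hx t h0 h1)).comp _ (hasFDerivAt_prodMk_right x _))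
  have hinr : ∀ i, ‖ContinuousLinearMap.inr 𝕂 (X i) (Y i)‖ ≤ 1 := fun i =>
    ContinuousLinearMap.norm_inr_le_one 𝕂 (X i) (Y i)
  have h1 : ∀ (i : ι) (x : X i) (hx : x ∈ U i), ∀ t : ℝ, 0 ≤ t → t ≤ 1 →
      f ⟨i, x, hx⟩ * ‖(fderiv 𝕂 (β i) (x, γ i x + (t : 𝕂) • η i x)).comp
        (ContinuousLinearMap.inr 𝕂 (X i) (Y i))‖ₑ ≤ (G₁ + G₂) ⟨i, x, hx⟩ := by
    intro i x hx t h0 h1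
    refine le_trans ?_ ((hb₁ i x hx _ (hst.mem i x hx t h0 h1) (hst.enorm_le hw hx h0 h1)).trans
      le_self_add)
    rw [← enorm_iteratedFDeriv_fderiv, enorm_iteratedFDeriv_zero]
    refine mul_le_mul_right (enorm_le_iff_norm_le.2 ?_) _
    exact (ContinuousLinearMap.opNorm_comp_le _ _).trans
      (mul_le_of_le_one_right (norm_nonneg _) (hinr i))
  have h2 : ∀ (i : ι) (x : X i) (hx : x ∈ U i), ∀ t : ℝ, 0 ≤ t → t ≤ 1 →
      f ⟨i, x, hx⟩ * ‖((ContinuousLinearMap.compL 𝕂 (Y i) (X i × Y i) (Z i)).flip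
        (ContinuousLinearMap.inr 𝕂 (X i) (Y i))).comp
          ((fderiv 𝕂 (fderiv 𝕂 (β i)) (x, γ i x + (t : 𝕂) • η i x)).comp
            (ContinuousLinearMap.inr 𝕂 (X i) (Y i)))‖ₑ ≤ (G₁ + G₂) ⟨i, x, hx⟩ := by
    intro i x hx t h0 h1
    refine le_trans ?_ ((hb₂ i x hx _ (hst.mem i x hx t h0 h1) (hst.enorm_le hw hx h0 h1)).trans
      le_add_self)
    rw [← enorm_fderiv_fderiv_eq]
    refine mul_le_mul_right (enorm_le_iff_norm_le.2 ?_) _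
    have hflip : ‖(ContinuousLinearMap.compL 𝕂 (Y i) (X i × Y i) (Z i)).flip
        (ContinuousLinearMap.inr 𝕂 (X i) (Y i))‖ ≤ 1 :=
      (ContinuousLinearMap.le_of_opNorm_le _ ((ContinuousLinearMap.opNorm_flip _).trans_le
        (ContinuousLinearMap.norm_compL_le 𝕂 (Y i) (X i × Y i) (Z i))) _).trans
          (by rw [one_mul]; exact hinr i)
    refine (ContinuousLinearMap.opNorm_comp_le _ _).trans
      ((mul_le_of_le_one_left (norm_nonneg _) hflip).trans ?_)
    exact (ContinuousLinearMap.opNorm_comp_le _ _).trans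
      (mul_le_of_le_one_right (norm_nonneg _) (hinr i))
  have hu' : ∀ (i : ι) (x : X i) (hx : x ∈ U i),
      (G₁ + G₂) ⟨i, x, hx⟩ * ‖η i x‖ₑ ≤ wNorm 𝕂 (G₁ + G₂) 0 η := fun i x hx =>
    le_wNorm_zero _ η hx
  constructor
  · rw [wNorm_zero]
    refine le_trans (iSup_le fun ⟨i, x, hx⟩ => ?_) hC'
    exact (mul_enorm_add_sub_le (𝕂 := 𝕂) (φ := fun y => β i (x, y))
      (φ' := fun y => (fderiv 𝕂 (β i) (x, y)).comp (ContinuousLinearMap.inr 𝕂 (X i) (Y i)))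
      (hphi i x hx) (h1 i x hx)).trans (hu' i x hx)
  · rw [wNorm_zero]
    refine le_trans (iSup_le fun ⟨i, x, hx⟩ => ?_) (mul_le_mul_left hC' _)
    refine (mul_enorm_add_sub_sub_le (𝕂 := 𝕂) (φ := fun y => β i (x, y))
      (φ' := fun y => (fderiv 𝕂 (β i) (x, y)).comp (ContinuousLinearMap.inr 𝕂 (X i) (Y i)))
      (φ'' := fun y => ((ContinuousLinearMap.compL 𝕂 (Y i) (X i × Y i) (Z i)).flip
        (ContinuousLinearMap.inr 𝕂 (X i) (Y i))).comp ((fderiv 𝕂 (fderiv 𝕂 (β i)) (x, y)).comp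
          (ContinuousLinearMap.inr 𝕂 (X i) (Y i))))
      (hphi i x hx) (hphi' i x hx) (h2 i x hx)).trans ?_
    -- Of the two factors `‖η i x‖`, one absorbs the dominated weight; the other is bounded by the
    -- `w`-quasinorm, as `1 ≤ w`.
    exact mul_le_mul' (hu' i x hx) (enorm_le_wNorm_zero hw η hx)

theorem hasTaylorEstimate_succ (h : IsAdmissible 𝕂 W V β)
    (hℓ : HasTaylorEstimate 𝕂 W w (fun i => V i ×ˢ (univ : Set (X i →L[𝕂] Y i))) (jetMap 𝕂 β) ℓ) :
    HasTaylorEstimate 𝕂 W w V β (ℓ + 1) := by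
  intro f hf R
  obtain ⟨s, hs, C, hC⟩ := hℓ f hf R
  -- Passing from jets to functions costs a factor `2` per sum of quasinorms: one sum in the
  -- Lipschitz estimate, two in the remainder estimate.
  refine ⟨s, hs, 4 * C, fun γ η hst => ?_⟩
  obtain ⟨h1, h2⟩ := hC _ _ hst.famJet
  have hsum : ∑ f ∈ s, ∑ m ∈ Finset.range (ℓ + 1), wNorm 𝕂 f m (famJet 𝕂 η) ≤
      2 * ∑ f ∈ s, ∑ m ∈ Finset.range (ℓ + 1 + 1), wNorm 𝕂 f m η := by
    rw [Finset.mul_sum]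
    exact Finset.sum_le_sum fun f _ => sum_wNorm_famJet_le f hst.contDiffOn_right
  have hsumw := sum_wNorm_famJet_le w hst.contDiffOn_right
  have hadd : ∀ i, ∀ x ∈ U i, HasFDerivAt (superpos β (γ + η) i)
      (superpos (jetMap 𝕂 β) (famJet 𝕂 γ + famJet 𝕂 η) i x) x := fun i x hx => by
    have hγ := (hst.contDiffOn_left i).differentiableAt_of_opens hx
    have hη := (hst.contDiffOn_right i).differentiableAt_of_opens hx
    have := h.hasFDerivAt_superpos hx (γ := γ + η) (hγ.add hη) (hst.mem_add hx)
    convert this using 1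
    simp [superpos, famJet, famPair, fderiv_add hγ hη]
  have hγ : ∀ i, ∀ x ∈ U i, HasFDerivAt (superpos β γ i)
      (superpos (jetMap 𝕂 β) (famJet 𝕂 γ) i x) x := fun i x hx =>
    h.hasFDerivAt_superpos hx ((hst.contDiffOn_left i).differentiableAt_of_opens hx)
      (hst.mem_left hx)
  constructor
  · rw [wNorm_succ_of_hasFDerivAt (φ := superpos β (γ + η) - superpos β γ)
      (φ' := superpos (jetMap 𝕂 β) (famJet 𝕂 γ + famJet 𝕂 η) -
        superpos (jetMap 𝕂 β) (famJet 𝕂 γ)) f fun i x hx => (hadd i x hx).sub (hγ i x hx)]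
    refine h1.trans ((mul_le_mul_right hsum _).trans ?_)
    rw [← mul_assoc]
    gcongr
    push_cast
    rw [mul_comm]
    gcongr
    norm_num
  · rw [wNorm_succ_of_hasFDerivAt
      (φ := superpos β (γ + η) - superpos β γ - superpos (dirDeriv 𝕂 β) (famPair γ η))
      (φ' := superpos (jetMap 𝕂 β) (famJet 𝕂 γ + famJet 𝕂 η) -
      superpos (jetMap 𝕂 β) (famJet 𝕂 γ) -
        superpos (dirDeriv 𝕂 (jetMap 𝕂 β)) (famPair (famJet 𝕂 γ) (famJet 𝕂 η))) f
          fun i x hx => ((hadd i x hx).sub (hγ i x hx)).sub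
            (h.hasFDerivAt_superpos_dirDeriv hx
              ((hst.contDiffOn_left i).differentiableAt_of_opens hx)
              ((hst.contDiffOn_right i).differentiableAt_of_opens hx) (hst.mem_left hx))]
    refine h2.trans ((mul_le_mul' (mul_le_mul_right hsum _) hsumw).trans (le_of_eq ?_))
    push_cast
    ring

end Estimates

/-! ### Taylor estimates of all orders -/

section Induction

universe u v w

variable {𝕂 : Type*} [RCLike 𝕂] {ι : Type*} {X : ι → Type u} [∀ i, NormedAddCommGroup (X i)]
  [∀ i, NormedSpace 𝕂 (X i)] {U : ∀ i, Opens (X i)} {W : Set (EWeight U)} {w : EWeight U}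

/-- Passing to jets replaces `Y i` by `Y i × (X i →L[𝕂] Y i)` and `Z i` by `X i →L[𝕂] Z i`, which
may change universes. The levels `max u v` and `max u w` are stable under this, so the induction
runs there; in general, one first step leads into these levels. -/
theorem hasTaylorEstimate_max (hw : ∀ p, 1 ≤ w p) (ℓ : ℕ) :
    ∀ {Y : ι → Type (max u v)} [∀ i, NormedAddCommGroup (Y i)] [∀ i, NormedSpace 𝕂 (Y i)]
      {Z : ι → Type (max u w)} [∀ i, NormedAddCommGroup (Z i)] [∀ i, NormedSpace 𝕂 (Z i)]
      {V : ∀ i, Set (Y i)} {β : ∀ i, X i × Y i → Z i}, IsAdmissible 𝕂 W V β →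
      HasTaylorEstimate 𝕂 W w V β ℓ := by
  induction ℓ with
  | zero => exact fun h => hasTaylorEstimate_zero h hw
  | succ ℓ ih => exact fun h => hasTaylorEstimate_succ h (ih (isAdmissible_jetMap h))

variable {Y : ι → Type v} [∀ i, NormedAddCommGroup (Y i)] [∀ i, NormedSpace 𝕂 (Y i)]
  {Z : ι → Type w} [∀ i, NormedAddCommGroup (Z i)] [∀ i, NormedSpace 𝕂 (Z i)]
  {V : ∀ i, Set (Y i)} {β : ∀ i, X i × Y i → Z i}

theorem IsAdmissible.hasTaylorEstimate (h : IsAdmissible 𝕂 W V β) (hw : ∀ p, 1 ≤ w p) (ℓ : ℕ) :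
    HasTaylorEstimate 𝕂 W w V β ℓ := by
  cases ℓ with
  | zero => exact hasTaylorEstimate_zero h hw
  | succ ℓ =>
    exact hasTaylorEstimate_succ h (hasTaylorEstimate_max.{u, v, w} hw ℓ (isAdmissible_jetMap h))

end Induction

/-! ### Superposition operators between weighted restricted products -/

section Products

open scoped NNReal

variable {𝕂 : Type*} [RCLike 𝕂] {ι : Type*} {X : ι → Type*} [∀ i, NormedAddCommGroup (X i)]
  [∀ i, NormedSpace 𝕂 (X i)] {U : ∀ i, Opens (X i)}
  {Y : ι → Type*} [∀ i, NormedAddCommGroup (Y i)] [∀ i, NormedSpace 𝕂 (Y i)]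
  {Z : ι → Type*} [∀ i, NormedAddCommGroup (Z i)] [∀ i, NormedSpace 𝕂 (Z i)]
  {W : Set (Weight U)} {k : ℕ∞}

/-- The absolute value of a weight. -/
noncomputable def absWeight (f : Weight U) : EWeight U := fun p => wabs (f p)

theorem wabs_coe (a : ℝ) : wabs (a : WithTop ℝ) = ‖a‖ₑ := by
  have h : Real.nnabs a = ‖a‖₊ := NNReal.coe_injective (by simp)
  exact congrArg ENNReal.ofNNReal h

theorem famNorm_eq_wNorm (f : Weight U) (ℓ : ℕ) (φ : ∀ i, U i → Y i) :
    famNorm 𝕂 f ℓ φ = wNorm 𝕂 (absWeight f) ℓ fun i => ext0 (U i) (φ i) := by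
  unfold famNorm qnorm wNorm absWeight
  rw [iSup_sigma]
  congr 1 with i
  congr 1 with x
  rw [iteratedFDerivWithin_of_isOpen ℓ (U i).isOpen x.2]

namespace WeightedProducts.WProd

theorem toFam_injective : Function.Injective (toFam : WProd 𝕂 U Y W k → _) :=
  Subtype.val_injective

theorem toFam_sub (γ η : WProd 𝕂 U Y W k) : (γ - η).toFam = γ.toFam - η.toFam := rfl

/-- The family of extensions by `0` of the components of an element of the weighted product. -/
noncomputable def ext (γ : WProd 𝕂 U Y W k) : ∀ i, X i → Y i := fun i => ext0 (U i) (γ.toFam i)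

theorem ext_apply (γ : WProd 𝕂 U Y W k) {i : ι} {x : X i} (hx : x ∈ U i) :
    γ.ext i x = γ.toFam i ⟨x, hx⟩ := ext0_apply (U i) (γ.toFam i) ⟨x, hx⟩

theorem ext_sub_apply (γ η : WProd 𝕂 U Y W k) {i : ι} {x : X i} (hx : x ∈ U i) :
    (γ - η).ext i x = γ.ext i x - η.ext i x := by
  simp only [ext_apply _ hx, toFam_sub]
  rfl

theorem contDiffOn_ext (γ : WProd 𝕂 U Y W k) (i : ι) : ContDiffOn 𝕂 k (γ.ext i) (U i) :=
  γ.toFam_mem.1 i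

theorem contDiffOn_ext_nat (γ : WProd 𝕂 U Y W k) {ℓ : ℕ} (hℓ : (ℓ : ℕ∞) ≤ k) (i : ι) :
    ContDiffOn 𝕂 ℓ (γ.ext i) (U i) := γ.contDiffOn hℓ i

theorem wNorm_ext_lt_top (γ : WProd 𝕂 U Y W k) {f : EWeight U} (hf : f ∈ absWeight '' W) {ℓ : ℕ}
    (hℓ : (ℓ : ℕ∞) ≤ k) : wNorm 𝕂 f ℓ γ.ext < ∞ := by
  obtain ⟨f, hf, rfl⟩ := hf
  unfold ext
  rw [← famNorm_eq_wNorm]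
  exact γ.toFam_mem.2 f hf ℓ hℓ

theorem wNorm_ext_smul (c : 𝕂) (γ : WProd 𝕂 U Y W k) {f : EWeight U} (hf : f ∈ absWeight '' W)
    {ℓ : ℕ} (hℓ : (ℓ : ℕ∞) ≤ k) : wNorm 𝕂 f ℓ (c • γ).ext = ‖c‖ₑ * wNorm 𝕂 f ℓ γ.ext := by
  obtain ⟨f, hf, rfl⟩ := hf
  unfold ext
  rw [← famNorm_eq_wNorm, ← famNorm_eq_wNorm, toFam_smul]
  exact famNorm_smul f ℓ c (γ.contDiffOn hℓ)

/-- Convergence in the weighted product is convergence in all quasinorms. -/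
theorem tendsto_nhds_iff {α : Type*} {l : Filter α} {u : α → WProd 𝕂 U Y W k}
    {γ : WProd 𝕂 U Y W k} : Tendsto u l (𝓝 γ) ↔ ∀ f ∈ absWeight '' W, ∀ ℓ : ℕ, (ℓ : ℕ∞) ≤ k →
      Tendsto (fun a => wNorm 𝕂 f ℓ (u a - γ).ext) l (𝓝 0) := by
  have key : ∀ p : W × {ℓ : ℕ // (ℓ : ℕ∞) ≤ k}, ∀ η : WProd 𝕂 U Y W k,
      seminorms 𝕂 U Y W k p η = (wNorm 𝕂 (absWeight p.1.1) p.2.1 η.ext).toReal := fun p η => by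
    unfold ext
    rw [← famNorm_eq_wNorm]
    rfl
  rw [(withSeminorms W).tendsto_nhds]
  constructor
  · rintro h _ ⟨f, hf, rfl⟩ ℓ hℓ
    rw [ENNReal.tendsto_nhds_zero]
    intro ε hε
    rcases eq_or_ne ε ∞ with rfl | hε'
    · simp
    filter_upwards [h (⟨f, hf⟩, ⟨ℓ, hℓ⟩) ε.toReal (ENNReal.toReal_pos hε.ne' hε')] with a ha
    rw [key] at ha
    exact ((ENNReal.toReal_lt_toReal (wNorm_ext_lt_top _ ⟨f, hf, rfl⟩ hℓ).ne hε').1 ha).le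
  · intro h p ε hε
    filter_upwards [(h _ ⟨p.1.1, p.1.2, rfl⟩ p.2.1 p.2.2).eventually_lt_const
      (ENNReal.ofReal_pos.2 hε)] with a ha
    rw [key]
    exact (ENNReal.lt_ofReal_iff_toReal_lt (wNorm_ext_lt_top _ ⟨_, p.1.2, rfl⟩ p.2.2).ne).1 ha

/-- An element of the weighted product, from a family of functions on the spaces `X i`. -/
noncomputable def ofExt (φ : ∀ i, X i → Y i) (hφ : ∀ i, ContDiffOn 𝕂 k (φ i) (U i))
    (hf : ∀ f ∈ absWeight '' W, ∀ ℓ : ℕ, (ℓ : ℕ∞) ≤ k → wNorm 𝕂 f ℓ φ < ∞) : WProd 𝕂 U Y W k :=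
  show weightedSubmodule 𝕂 U Y W k from
    ⟨fun i x => φ i x,
      fun i => (hφ i).congr fun x hx => ext0_apply (U i) (fun x : U i => φ i x) ⟨x, hx⟩,
      fun f h ℓ hℓ => by
        rw [famNorm_eq_wNorm, wNorm_congr (ψ := φ) _ _ fun i x hx =>
          ext0_apply (U i) (fun x : U i => φ i x) ⟨x, hx⟩]
        exact hf _ ⟨f, h, rfl⟩ ℓ hℓ⟩

theorem toFam_ofExt (φ : ∀ i, X i → Y i) (hφ : ∀ i, ContDiffOn 𝕂 k (φ i) (U i))
    (hf : ∀ f ∈ absWeight '' W, ∀ ℓ : ℕ, (ℓ : ℕ∞) ≤ k → wNorm 𝕂 f ℓ φ < ∞) (i : ι) (x : U i) :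
    (ofExt (W := W) φ hφ hf).toFam i x = φ i x := rfl

/-- The element `x ↦ (γ i x, η i x)` of the weighted product. -/
noncomputable def prodMk (γ : WProd 𝕂 U Y W k) (η : WProd 𝕂 U Z W k) :
    WProd 𝕂 U (fun i => Y i × Z i) W k :=
  ofExt (famPair γ.ext η.ext) (fun i => (γ.contDiffOn_ext i).prodMk (η.contDiffOn_ext i))
    (fun f hf ℓ hℓ => (wNorm_famPair_le f ℓ (γ.contDiffOn_ext_nat hℓ)
      (η.contDiffOn_ext_nat hℓ)).trans_lt
        (max_lt (γ.wNorm_ext_lt_top hf hℓ) (η.wNorm_ext_lt_top hf hℓ)))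

theorem toFam_prodMk (γ : WProd 𝕂 U Y W k) (η : WProd 𝕂 U Z W k) (i : ι) (x : U i) :
    (prodMk γ η).toFam i x = (γ.toFam i x, η.toFam i x) :=
  Prod.ext (ext_apply γ x.2) (ext_apply η x.2)

/-- The pairing `(γ, η) ↦ (x ↦ (γ i x, η i x))` as a linear map. -/
noncomputable def pair : WProd 𝕂 U Y W k × WProd 𝕂 U Z W k →ₗ[𝕂]
    WProd 𝕂 U (fun i => Y i × Z i) W k where
  toFun p := prodMk p.1 p.2
  map_add' p q := by
    apply toFam_injective
    funext i x
    rw [toFam_add, Pi.add_apply, Pi.add_apply, toFam_prodMk, toFam_prodMk, toFam_prodMk]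
    rfl
  map_smul' c p := by
    apply toFam_injective
    funext i x
    rw [RingHom.id_apply, toFam_smul, Pi.smul_apply, Pi.smul_apply, toFam_prodMk, toFam_prodMk]
    rfl

theorem toFam_pair (γ : WProd 𝕂 U Y W k) (η : WProd 𝕂 U Z W k) (i : ι) (x : U i) :
    (pair (γ, η)).toFam i x = (γ.toFam i x, η.toFam i x) := toFam_prodMk γ η i x

theorem wNorm_ext_pair_le (f : EWeight U) {ℓ : ℕ} (hℓ : (ℓ : ℕ∞) ≤ k) (γ : WProd 𝕂 U Y W k)
    (η : WProd 𝕂 U Z W k) :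
    wNorm 𝕂 f ℓ (pair (γ, η)).ext ≤ max (wNorm 𝕂 f ℓ γ.ext) (wNorm 𝕂 f ℓ η.ext) := by
  rw [wNorm_congr (ψ := famPair γ.ext η.ext) f ℓ fun i x hx => by
    rw [ext_apply _ hx, toFam_pair, famPair, ext_apply _ hx, ext_apply _ hx]]
  exact wNorm_famPair_le f ℓ (γ.contDiffOn_ext_nat hℓ) (η.contDiffOn_ext_nat hℓ)

theorem continuous_pair : Continuous (pair : WProd 𝕂 U Y W k × WProd 𝕂 U Z W k →ₗ[𝕂]
    WProd 𝕂 U (fun i => Y i × Z i) W k) := by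
  rw [continuous_iff_continuousAt]
  intro p
  refine tendsto_nhds_iff.2 fun f hf ℓ hℓ => ?_
  have h1 := tendsto_nhds_iff.1 (continuous_fst.tendsto p) f hf ℓ hℓ
  have h2 := tendsto_nhds_iff.1 (continuous_snd.tendsto p) f hf ℓ hℓ
  have h3 := h1.max h2
  rw [max_self] at h3
  refine tendsto_of_tendsto_of_tendsto_of_le_of_le tendsto_const_nhds h3 (fun _ => zero_le)
    fun q => ?_
  rw [← map_sub]
  exact wNorm_ext_pair_le f hℓ (q - p).1 (q - p).2

variable (k) in
open Classical in
/-- The superposition operator `γ ↦ (x ↦ β i (x, γ i x))`, with the value `0` for those `γ` which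
it does not map to the weighted product. -/
noncomputable def superposMap (W : Set (Weight U)) (β : ∀ i, X i × Y i → Z i)
    (γ : WProd 𝕂 U Y W k) : WProd 𝕂 U Z W k :=
  if h : (∀ i, ContDiffOn 𝕂 k (superpos β γ.ext i) (U i)) ∧
      ∀ f ∈ absWeight '' W, ∀ ℓ : ℕ, (ℓ : ℕ∞) ≤ k → wNorm 𝕂 f ℓ (superpos β γ.ext) < ∞ then
    ofExt (superpos β γ.ext) h.1 h.2
  else 0

variable {V : ∀ i, Set (Y i)} {β : ∀ i, X i × Y i → Z i} {w : EWeight U}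

theorem exists_forall_wNorm_ext_le (γ : WProd 𝕂 U Y W k) {f : EWeight U}
    (hf : f ∈ absWeight '' W) {ℓ : ℕ} (hℓ : (ℓ : ℕ∞) ≤ k) :
    ∃ R : ℝ≥0, ∀ m ≤ ℓ, wNorm 𝕂 f m γ.ext ≤ R := by
  refine ⟨∑ m ∈ Finset.range (ℓ + 1), (wNorm 𝕂 f m γ.ext).toNNReal, fun m hm => ?_⟩
  rw [← ENNReal.coe_toNNReal
    (γ.wNorm_ext_lt_top hf ((by exact_mod_cast hm : (m : ℕ∞) ≤ ℓ).trans hℓ)).ne]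
  exact ENNReal.coe_le_coe.2 (Finset.single_le_sum
    (f := fun m => (wNorm 𝕂 f m γ.ext).toNNReal) (fun _ _ => zero_le)
    (Finset.mem_range.2 (Nat.lt_succ_of_le hm)))

theorem sum_wNorm_ext_lt_top (γ : WProd 𝕂 U Y W k) {s : Finset (EWeight U)}
    (hs : (s : Set (EWeight U)) ⊆ absWeight '' W) {ℓ : ℕ} (hℓ : (ℓ : ℕ∞) ≤ k) :
    ∑ f ∈ s, ∑ m ∈ Finset.range (ℓ + 1), wNorm 𝕂 f m γ.ext < ∞ :=
  ENNReal.sum_lt_top.2 fun f hf => ENNReal.sum_lt_top.2 fun m hm =>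
    γ.wNorm_ext_lt_top (hs hf) ((by
      exact_mod_cast Nat.lt_succ_iff.1 (Finset.mem_range.1 hm) : (m : ℕ∞) ≤ ℓ).trans hℓ)

/-- What has to be seen is that the superposition has finite quasinorms, so that the default value
`0` is not taken. This is the Lipschitz estimate for the step from `0` to `γ`: star-shapedness keeps
the segment in `V i`, and the superposition vanishes at `0`. -/
theorem toFam_superposMap (h : IsAdmissible 𝕂 (absWeight '' W) V β) (hwW : w ∈ absWeight '' W)
    (hw : ∀ p, 1 ≤ w p) {γ : WProd 𝕂 U Y W k} (hγ : ∀ i x, γ.toFam i x ∈ V i) (i : ι) (x : U i) :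
    (superposMap k W β γ).toFam i x = β i (x, γ.toFam i x) := by
  have hγV : ∀ i, ∀ x ∈ U i, γ.ext i x ∈ V i := fun i x hx => by
    rw [ext_apply _ hx]; exact hγ i _
  have hmem : (∀ i, ContDiffOn 𝕂 k (superpos β γ.ext i) (U i)) ∧
      ∀ f ∈ absWeight '' W, ∀ ℓ : ℕ, (ℓ : ℕ∞) ≤ k → wNorm 𝕂 f ℓ (superpos β γ.ext) < ∞ := by
    refine ⟨fun i => h.contDiffOn_superpos (γ.contDiffOn_ext i) (hγV i), fun f hf ℓ hℓ => ?_⟩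
    obtain ⟨R, hR⟩ := γ.exists_forall_wNorm_ext_le hwW hℓ
    obtain ⟨s, hs, C, hC⟩ := h.hasTaylorEstimate hw ℓ f hf R
    have hst : IsStep 𝕂 (absWeight '' W) w V ℓ R 0 γ.ext :=
      { contDiffOn_left := fun _ => contDiffOn_const
        contDiffOn_right := γ.contDiffOn_ext_nat hℓ
        finite := fun f hf m hm =>
          γ.wNorm_ext_lt_top hf ((by exact_mod_cast hm : (m : ℕ∞) ≤ ℓ).trans hℓ)
        mem := fun i x hx t h0 h1 => by
          simpa using h.starShaped i _ (hγV i x hx) t h0 h1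
        bound_left := fun m _ => by
          simp [wNorm, ← ofReal_norm]
        bound_right := hR }
    have h1 := (hC _ _ hst).1
    rw [wNorm_congr (ψ := superpos β γ.ext) f ℓ fun i x hx => by
      simp [superpos, h.map_zero i x hx]] at h1
    exact h1.trans_lt (ENNReal.mul_lt_top ENNReal.coe_lt_top (γ.sum_wNorm_ext_lt_top hs hℓ))
  rw [superposMap, dif_pos hmem, toFam_ofExt, superpos, ext_apply _ x.2]

end WeightedProducts.WProd

end Products

/-! ### Smoothness of superposition operators -/

section Bastiani

/-- The differential of `f ∘ A` is `df ∘ (A × A)`, with `A × A` again continuous and linear; so the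
induction must vary the spaces. -/
theorem isCOn_comp_linear {𝕂 : Type*} [RCLike 𝕂] {F : Type*} [AddCommGroup F] [Module 𝕂 F]
    [TopologicalSpace F] (n : ℕ) :
    ∀ {E E' : Type*} [AddCommGroup E] [Module 𝕂 E] [TopologicalSpace E] [AddCommGroup E']
      [Module 𝕂 E'] [TopologicalSpace E'] (A : E' →ₗ[𝕂] E), Continuous A →
      ∀ {Ω : Set E} {f : E → F}, IsCOn 𝕂 n Ω f → IsCOn 𝕂 n (A ⁻¹' Ω) (f ∘ A) := by
  induction n with
  | zero => exact fun A hA Ω f hf => ContinuousOn.comp hf hA.continuousOn fun _ h => h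
  | succ n ih =>
    rintro E E' _ _ _ _ _ _ A hA Ω f ⟨df, h1, h2, h3⟩
    have hA2 : Continuous (A.prodMap A) := (hA.comp continuous_fst).prodMk (hA.comp continuous_snd)
    have hpre : (A.prodMap A) ⁻¹' (Ω ×ˢ univ) = (A ⁻¹' Ω) ×ˢ (univ : Set E') := by
      ext p
      simp
    refine ⟨df ∘ A.prodMap A, fun u hu x => ?_, ?_, ?_⟩
    · simpa using h1 (A u) hu (A x)
    · exact h2.comp hA2.continuousOn fun p hp => ⟨hp.1, mem_univ _⟩
    · rw [← hpre]
      exact ih _ hA2 h3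

end Bastiani

section Smooth

open scoped NNReal

variable {𝕂 : Type*} [RCLike 𝕂] {ι : Type*} {X : ι → Type*} [∀ i, NormedAddCommGroup (X i)]
  [∀ i, NormedSpace 𝕂 (X i)] {U : ∀ i, Opens (X i)}
  {Y : ι → Type*} [∀ i, NormedAddCommGroup (Y i)] [∀ i, NormedSpace 𝕂 (Y i)]
  {Z : ι → Type*} [∀ i, NormedAddCommGroup (Z i)] [∀ i, NormedSpace 𝕂 (Z i)]
  {W : Set (Weight U)} {k : ℕ∞}

namespace WeightedProducts.WProd

variable (𝕂 W k) in
/-- The elements of the weighted product which have, with respect to the weight `ω`, a positive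
distance to the complements of the sets `V i`. -/
def omegaSet (V : ∀ i, Set (Y i)) (ω : (Σ i, U i) → ℝ) : Set (WProd 𝕂 U Y W k) :=
  {γ | ∃ r > 0, ∀ i, ∀ x : U i, Metric.ball (γ.toFam i x) (r / |ω ⟨i, x⟩|) ⊆ V i}

variable {V : ∀ i, Set (Y i)} {β : ∀ i, X i × Y i → Z i} {ω : (Σ i, U i) → ℝ}

theorem toFam_mem_of_mem_omegaSet (hω : ∀ p, 1 ≤ ‖ω p‖ₑ) {γ : WProd 𝕂 U Y W k}
    (hγ : γ ∈ omegaSet 𝕂 W k V ω) (i : ι) (x : U i) : γ.toFam i x ∈ V i := by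
  obtain ⟨r, hr, h⟩ := hγ
  refine h i x (Metric.mem_ball_self (div_pos hr (abs_pos.2 fun h0 => ?_)))
  simpa [h0] using hω ⟨i, x⟩

theorem absWeight_coe (ω : (Σ i, U i) → ℝ) :
    absWeight (fun p => (ω p : WithTop ℝ)) = fun p => ‖ω p‖ₑ :=
  funext fun p => wabs_coe (ω p)

theorem norm_lt_of_wNorm_lt {φ : ∀ i, X i → Y i} {r : ℝ} (hω : ∀ p, 1 ≤ ‖ω p‖ₑ)
    (h : wNorm 𝕂 (fun p => ‖ω p‖ₑ) 0 φ < ENNReal.ofReal r) {i : ι} {x : X i} (hx : x ∈ U i) :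
    ‖φ i x‖ < r / |ω ⟨i, x, hx⟩| := by
  have h0 : ω ⟨i, x, hx⟩ ≠ 0 := fun h0 => by simpa [h0] using hω ⟨i, x, hx⟩
  rw [lt_div_iff₀ (abs_pos.2 h0), mul_comm]
  have h1 := (le_wNorm_zero (𝕂 := 𝕂) (fun p => ‖ω p‖ₑ) φ hx).trans_lt h
  rw [← ofReal_norm, ← ofReal_norm, ← ENNReal.ofReal_mul (norm_nonneg _)] at h1
  exact (ENNReal.ofReal_lt_ofReal_iff_of_nonneg (by positivity)).1 h1

theorem eventually_wNorm_sub_lt (hωW : (fun p => (ω p : WithTop ℝ)) ∈ W)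
    (γ : WProd 𝕂 U Y W k) {r : ℝ} (hr : 0 < r) :
    ∀ᶠ η in 𝓝 γ, wNorm 𝕂 (fun p => ‖ω p‖ₑ) 0 (η - γ).ext < ENNReal.ofReal r :=
  (tendsto_nhds_iff.1 tendsto_id _ ⟨_, hωW, absWeight_coe ω⟩ 0 (by simp)).eventually_lt_const
    (ENNReal.ofReal_pos.2 hr)

theorem isOpen_omegaSet (hω : ∀ p, 1 ≤ ‖ω p‖ₑ) (hωW : (fun p => (ω p : WithTop ℝ)) ∈ W) :
    IsOpen (omegaSet 𝕂 W k V ω) := by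
  rw [isOpen_iff_mem_nhds]
  rintro γ ⟨r, hr, h⟩
  filter_upwards [eventually_wNorm_sub_lt hωW γ (half_pos hr)] with η hη
  -- An increment of `ω`-quasinorm less than `r / 2` moves the centre at `x` by less than `(r / 2) /
  -- |ω x|`, leaving room for a ball of the same radius.
  refine ⟨r / 2, half_pos hr, fun i x => Subset.trans (Metric.ball_subset_ball' ?_) (h i x)⟩
  have h1 := norm_lt_of_wNorm_lt hω hη x.2
  rw [ext_apply _ x.2, toFam_sub] at h1
  rw [dist_eq_norm]
  refine (add_le_add_right h1.le _).trans (le_of_eq ?_)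
  rw [← add_div, add_halves]

/-- Near an element of `omegaSet`, increments are admissible steps. -/
theorem isStep_of_forall_wNorm_le (hω : ∀ p, 1 ≤ ‖ω p‖ₑ) {γ η : WProd 𝕂 U Y W k} {r : ℝ}
    (hr : ∀ i, ∀ x : U i, Metric.ball (γ.toFam i x) (r / |ω ⟨i, x⟩|) ⊆ V i) {ℓ : ℕ}
    (hℓ : (ℓ : ℕ∞) ≤ k) {R : ℝ≥0} (hγ : ∀ m ≤ ℓ, wNorm 𝕂 (fun p => ‖ω p‖ₑ) m γ.ext ≤ R)
    (hη : ∀ m ≤ ℓ, wNorm 𝕂 (fun p => ‖ω p‖ₑ) m η.ext ≤ R)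
    (hηr : wNorm 𝕂 (fun p => ‖ω p‖ₑ) 0 η.ext < ENNReal.ofReal r) :
    IsStep 𝕂 (absWeight '' W) (fun p => ‖ω p‖ₑ) V ℓ R γ.ext η.ext where
  contDiffOn_left := γ.contDiffOn_ext_nat hℓ
  contDiffOn_right := η.contDiffOn_ext_nat hℓ
  finite f hf m hm := η.wNorm_ext_lt_top hf ((by exact_mod_cast hm : (m : ℕ∞) ≤ ℓ).trans hℓ)
  mem i x hx t h0 h1 := by
    refine hr i ⟨x, hx⟩ ?_
    rw [← ext_apply γ hx, mem_ball_iff_norm, add_sub_cancel_left, norm_smul, RCLike.norm_ofReal,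
      abs_of_nonneg h0]
    exact (mul_le_of_le_one_left (norm_nonneg _) h1).trans_lt (norm_lt_of_wNorm_lt hω hηr hx)
  bound_left := hγ
  bound_right := hη

theorem superpos_ext (h : IsAdmissible 𝕂 (absWeight '' W) V β) (hω : ∀ p, 1 ≤ ‖ω p‖ₑ)
    (hωW : (fun p => (ω p : WithTop ℝ)) ∈ W) {γ : WProd 𝕂 U Y W k}
    (hγ : γ ∈ omegaSet 𝕂 W k V ω) {i : ι} {x : X i} (hx : x ∈ U i) :
    (superposMap k W β γ).ext i x = superpos β γ.ext i x := by
  rw [ext_apply _ hx, toFam_superposMap h ⟨_, hωW, absWeight_coe ω⟩ hω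
    (toFam_mem_of_mem_omegaSet hω hγ), superpos, ext_apply _ hx]

theorem tendsto_sum_wNorm_sub {α : Type*} {l : Filter α} {u : α → WProd 𝕂 U Y W k}
    {γ : WProd 𝕂 U Y W k} (hu : Tendsto u l (𝓝 γ)) {s : Finset (EWeight U)}
    (hs : (s : Set (EWeight U)) ⊆ absWeight '' W) {ℓ : ℕ} (hℓ : (ℓ : ℕ∞) ≤ k) :
    Tendsto (fun a => ∑ f ∈ s, ∑ m ∈ Finset.range (ℓ + 1), wNorm 𝕂 f m (u a - γ).ext) l
      (𝓝 0) := by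
  have := tendsto_finsetSum s fun f hf => tendsto_finsetSum (Finset.range (ℓ + 1)) fun m hm =>
    tendsto_nhds_iff.1 hu f (hs hf) m ((by
      exact_mod_cast Nat.lt_succ_iff.1 (Finset.mem_range.1 hm) : (m : ℕ∞) ≤ ℓ).trans hℓ)
  simpa using this

/-- Eventually, the increments of a convergent family are admissible steps. -/
theorem exists_eventually_isStep (hω : ∀ p, 1 ≤ ‖ω p‖ₑ)
    (hωW : (fun p => (ω p : WithTop ℝ)) ∈ W) {γ : WProd 𝕂 U Y W k}
    (hγ : γ ∈ omegaSet 𝕂 W k V ω) {ℓ : ℕ} (hℓ : (ℓ : ℕ∞) ≤ k) :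
    ∃ R : ℝ≥0, ∀ᶠ η in 𝓝 γ,
      IsStep 𝕂 (absWeight '' W) (fun p => ‖ω p‖ₑ) V ℓ R γ.ext (η - γ).ext := by
  have hωW' : (fun p => ‖ω p‖ₑ) ∈ absWeight '' W := ⟨_, hωW, absWeight_coe ω⟩
  obtain ⟨R, hR⟩ := γ.exists_forall_wNorm_ext_le hωW' hℓ
  obtain ⟨r, hr, hball⟩ := hγ
  -- `R` bounds the finitely many quasinorms of `γ`, and those of the increment are eventually below
  -- `1`.
  refine ⟨R + 1, ?_⟩
  have h1 : ∀ᶠ η in 𝓝 γ, ∀ m ∈ Finset.range (ℓ + 1),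
      wNorm 𝕂 (fun p => ‖ω p‖ₑ) m (η - γ).ext < 1 :=
    (Finset.eventually_all _).2 fun m hm => (tendsto_nhds_iff.1 tendsto_id _ hωW' m ((by
      exact_mod_cast Nat.lt_succ_iff.1 (Finset.mem_range.1 hm) :
        (m : ℕ∞) ≤ ℓ).trans hℓ)).eventually_lt_const one_pos
  filter_upwards [h1, eventually_wNorm_sub_lt hωW γ hr] with η hη hηr
  refine isStep_of_forall_wNorm_le hω hball hℓ (fun m hm => (hR m hm).trans ?_) (fun m hm =>
    (hη m (Finset.mem_range.2 (Nat.lt_succ_of_le hm))).le.trans ?_) hηr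
  · exact_mod_cast le_self_add
  · exact_mod_cast le_add_self

theorem continuousOn_superposMap (h : IsAdmissible 𝕂 (absWeight '' W) V β)
    (hω : ∀ p, 1 ≤ ‖ω p‖ₑ) (hωW : (fun p => (ω p : WithTop ℝ)) ∈ W) :
    ContinuousOn (superposMap k W β) (omegaSet 𝕂 W k V ω) := by
  intro γ hγ
  refine ContinuousAt.continuousWithinAt (tendsto_nhds_iff.2 fun f hf ℓ hℓ => ?_)
  obtain ⟨R, hR⟩ := exists_eventually_isStep hω hωW hγ hℓ
  obtain ⟨s, hs, C, hC⟩ := h.hasTaylorEstimate hω ℓ f hf R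
  have hlim := ENNReal.Tendsto.const_mul (tendsto_sum_wNorm_sub (tendsto_id (α := _) (x := 𝓝 γ))
    hs hℓ) (Or.inr (ENNReal.coe_ne_top (r := C)))
  rw [mul_zero] at hlim
  refine tendsto_of_tendsto_of_tendsto_of_le_of_le' tendsto_const_nhds hlim
    (.of_forall fun _ => zero_le) ?_
  filter_upwards [hR, (isOpen_omegaSet hω hωW).mem_nhds hγ] with η hst hη
  refine le_trans (le_of_eq (wNorm_congr f ℓ fun i x hx => ?_)) (hC _ _ hst).1
  rw [ext_sub_apply _ _ hx, superpos_ext h hω hωW hη hx, superpos_ext h hω hωW hγ hx,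
    Pi.sub_apply, Pi.sub_apply]
  simp [superpos, ext_sub_apply _ _ hx]

/-- Balls for the maximum norm are products of balls, and the second factor is unrestricted. Thus
the operator of the directional derivative lives on `omegaSet × univ`, the domain required for a
differential. -/
theorem pair_mem_omegaSet (hω : ∀ p, 1 ≤ ‖ω p‖ₑ) (γ η : WProd 𝕂 U Y W k) :
    pair (γ, η) ∈ omegaSet 𝕂 W k (fun i => V i ×ˢ (univ : Set (Y i))) ω ↔
      γ ∈ omegaSet 𝕂 W k V ω := by
  refine exists_congr fun r => and_congr_right fun hr => forall_congr' fun i =>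
    forall_congr' fun x => ?_
  have h0 : 0 < r / |ω ⟨i, x⟩| := div_pos hr (abs_pos.2 fun h0 => by
    simpa [h0] using hω ⟨i, x⟩)
  rw [toFam_pair, ← ball_prod_same]
  constructor
  · intro h y hy
    exact (h (mk_mem_prod hy (Metric.mem_ball_self h0))).1
  · exact fun h y hy => ⟨h hy.1, mem_univ _⟩

theorem superposMap_dirDeriv_smul (h : IsAdmissible 𝕂 (absWeight '' W) V β)
    (hω : ∀ p, 1 ≤ ‖ω p‖ₑ) (hωW : (fun p => (ω p : WithTop ℝ)) ∈ W) {γ : WProd 𝕂 U Y W k}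
    (hγ : γ ∈ omegaSet 𝕂 W k V ω) (η : WProd 𝕂 U Y W k) (t : 𝕂) :
    superposMap k W (dirDeriv 𝕂 β) (pair (γ, t • η)) =
      t • superposMap k W (dirDeriv 𝕂 β) (pair (γ, η)) := by
  have hωW' : (fun p => ‖ω p‖ₑ) ∈ absWeight '' W := ⟨_, hωW, absWeight_coe ω⟩
  apply toFam_injective
  funext i x
  have key : ∀ η : WProd 𝕂 U Y W k, (superposMap k W (dirDeriv 𝕂 β) (pair (γ, η))).toFam i x =
      fderiv 𝕂 (β i) (x, γ.toFam i x) (0, η.toFam i x) := fun η => by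
    rw [toFam_superposMap (isAdmissible_dirDeriv h) hωW' hω
      (toFam_mem_of_mem_omegaSet hω ((pair_mem_omegaSet hω γ η).2 hγ)), toFam_pair, dirDeriv]
  rw [key, toFam_smul, toFam_smul, Pi.smul_apply, Pi.smul_apply, Pi.smul_apply, Pi.smul_apply, key,
    ← map_smul, Prod.smul_mk, smul_zero]

/-- The difference quotient minus its limit is `t⁻¹` times the Taylor remainder for the increment `t
• η`. The remainder is at most `C (|t| K) (|t| L)`, so the error is at most `C K L |t|`. -/
theorem tendsto_diffQuot_superposMap (h : IsAdmissible 𝕂 (absWeight '' W) V β)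
    (hω : ∀ p, 1 ≤ ‖ω p‖ₑ) (hωW : (fun p => (ω p : WithTop ℝ)) ∈ W) {γ : WProd 𝕂 U Y W k}
    (hγ : γ ∈ omegaSet 𝕂 W k V ω) (η : WProd 𝕂 U Y W k) :
    Tendsto (fun t : 𝕂 => t⁻¹ • (superposMap k W β (γ + t • η) - superposMap k W β γ)) (𝓝[≠] 0)
      (𝓝 (superposMap k W (dirDeriv 𝕂 β) (pair (γ, η)))) := by
  have hωW' : (fun p => ‖ω p‖ₑ) ∈ absWeight '' W := ⟨_, hωW, absWeight_coe ω⟩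
  refine tendsto_nhds_iff.2 fun f hf ℓ hℓ => ?_
  obtain ⟨R, hR⟩ := exists_eventually_isStep hω hωW hγ hℓ
  obtain ⟨s, hs, C, hC⟩ := h.hasTaylorEstimate hω ℓ f hf R
  have hcurve : Tendsto (fun t : 𝕂 => γ + t • η) (𝓝[≠] 0) (𝓝 γ) := by
    have : ContinuousSMul 𝕂 (WProd 𝕂 U Y W k) := (withSeminorms W).continuousSMul
    have hc : Continuous fun t : 𝕂 => γ + t • η := by fun_prop
    simpa using (hc.tendsto 0).mono_left nhdsWithin_le_nhds
  set K := ∑ f ∈ s, ∑ m ∈ Finset.range (ℓ + 1), wNorm 𝕂 f m η.ext with hK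
  set L := ∑ m ∈ Finset.range (ℓ + 1), wNorm 𝕂 (fun p => ‖ω p‖ₑ) m η.ext with hL
  have hKtop : K < ∞ := η.sum_wNorm_ext_lt_top hs hℓ
  have hLtop : L < ∞ := by
    have h1 := η.sum_wNorm_ext_lt_top (s := {fun p => ‖ω p‖ₑ}) (by simpa using hωW') hℓ
    rwa [Finset.sum_singleton] at h1
  have hlim : Tendsto (fun t : 𝕂 => C * K * L * ‖t‖ₑ) (𝓝[≠] 0) (𝓝 0) := by
    have h1 : Tendsto (fun t : 𝕂 => ‖t‖ₑ) (𝓝[≠] 0) (𝓝 0) := by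
      simpa using (continuous_enorm.tendsto (0 : 𝕂)).mono_left nhdsWithin_le_nhds
    simpa using ENNReal.Tendsto.const_mul h1 (Or.inr (ENNReal.mul_ne_top
      (ENNReal.mul_ne_top (ENNReal.coe_ne_top (r := C)) hKtop.ne) hLtop.ne))
  refine tendsto_of_tendsto_of_tendsto_of_le_of_le' tendsto_const_nhds hlim
    (.of_forall fun _ => zero_le) ?_
  filter_upwards [hcurve.eventually hR,
    hcurve.eventually ((isOpen_omegaSet hω hωW).mem_nhds hγ), self_mem_nhdsWithin]
    with t hst hmem (ht : t ≠ 0)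
  rw [add_sub_cancel_left] at hst
  have hle : ∀ m, m ∈ Finset.range (ℓ + 1) → (m : ℕ∞) ≤ k := fun m hm => (by
    exact_mod_cast Nat.lt_succ_iff.1 (Finset.mem_range.1 hm) : (m : ℕ∞) ≤ ℓ).trans hℓ
  have hsumK : ∑ f ∈ s, ∑ m ∈ Finset.range (ℓ + 1), wNorm 𝕂 f m (t • η).ext = ‖t‖ₑ * K := by
    rw [hK, Finset.mul_sum]
    refine Finset.sum_congr rfl fun f hf => ?_
    rw [Finset.mul_sum]
    exact Finset.sum_congr rfl fun m hm => wNorm_ext_smul t η (hs hf) (hle m hm)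
  have hsumL : ∑ m ∈ Finset.range (ℓ + 1), wNorm 𝕂 (fun p => ‖ω p‖ₑ) m (t • η).ext =
      ‖t‖ₑ * L := by
    rw [hL, Finset.mul_sum]
    exact Finset.sum_congr rfl fun m hm => wNorm_ext_smul t η hωW' (hle m hm)
  have hest := (hC _ _ hst).2
  rw [hsumK, hsumL] at hest
  have heq : t⁻¹ • (superposMap k W β (γ + t • η) - superposMap k W β γ) -
      superposMap k W (dirDeriv 𝕂 β) (pair (γ, η)) =
      t⁻¹ • (superposMap k W β (γ + t • η) - superposMap k W β γ -
        superposMap k W (dirDeriv 𝕂 β) (pair (γ, t • η))) := by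
    rw [superposMap_dirDeriv_smul h hω hωW hγ, smul_sub t⁻¹ (_ - _), inv_smul_smul₀ ht]
  rw [heq, wNorm_ext_smul _ _ hf hℓ, enorm_inv ht]
  have h0 : ‖t‖ₑ ≠ 0 := by simpa using ht
  calc _ ≤ ‖t‖ₑ⁻¹ * (C * (‖t‖ₑ * K) * (‖t‖ₑ * L)) := by
        refine mul_le_mul_right (le_trans (le_of_eq (wNorm_congr f ℓ fun i x hx => ?_)) hest) _
        rw [ext_sub_apply _ _ hx, ext_sub_apply _ _ hx, superpos_ext h hω hωW hmem hx,
          superpos_ext h hω hωW hγ hx, superpos_ext (isAdmissible_dirDeriv h) hω hωW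
            ((pair_mem_omegaSet hω γ (t • η)).2 hγ) hx]
        simp only [superpos, famPair, Pi.sub_apply, Pi.add_apply, ext_apply _ hx, toFam_pair,
          toFam_add]
    _ = (‖t‖ₑ⁻¹ * ‖t‖ₑ) * (C * K * L * ‖t‖ₑ) := by ring
    _ = C * K * L * ‖t‖ₑ := by rw [ENNReal.inv_mul_cancel h0 enorm_ne_top, one_mul]

end WeightedProducts.WProd

end Smooth

/-! ### Induction on the degree of smoothness -/

section Induction

universe u v w

variable {𝕂 : Type*} [RCLike 𝕂] {ι : Type*} {X : ι → Type u} [∀ i, NormedAddCommGroup (X i)]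
  [∀ i, NormedSpace 𝕂 (X i)] {U : ∀ i, Opens (X i)}
  {Z : ι → Type w} [∀ i, NormedAddCommGroup (Z i)] [∀ i, NormedSpace 𝕂 (Z i)]
  {W : Set (Weight U)} {k : ℕ∞} {ω : (Σ i, U i) → ℝ}

namespace WeightedProducts.WProd

theorem isCOn_superposMap (hω : ∀ p, 1 ≤ ‖ω p‖ₑ) (hωW : (fun p => (ω p : WithTop ℝ)) ∈ W)
    (n : ℕ) : ∀ {Y : ι → Type v} [∀ i, NormedAddCommGroup (Y i)] [∀ i, NormedSpace 𝕂 (Y i)]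
      {V : ∀ i, Set (Y i)} {β : ∀ i, X i × Y i → Z i}, IsAdmissible 𝕂 (absWeight '' W) V β →
      IsCOn 𝕂 n (omegaSet 𝕂 W k V ω) (superposMap k W β) := by
  induction n with
  | zero => exact fun h => continuousOn_superposMap h hω hωW
  | succ n ih =>
    intro Y _ _ V β h
    have hpre : (pair : WProd 𝕂 U Y W k × WProd 𝕂 U Y W k →ₗ[𝕂] _) ⁻¹'
        omegaSet 𝕂 W k (fun i => V i ×ˢ (univ : Set (Y i))) ω =
          omegaSet 𝕂 W k V ω ×ˢ univ := by
      ext ⟨γ, η⟩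
      simp [pair_mem_omegaSet hω]
    refine ⟨superposMap k W (dirDeriv 𝕂 β) ∘ pair,
      fun γ hγ η => tendsto_diffQuot_superposMap h hω hωW hγ η, ?_, ?_⟩
    · rw [← hpre]
      exact (continuousOn_superposMap (isAdmissible_dirDeriv h) hω hωW).comp
        continuous_pair.continuousOn fun _ hp => hp
    · rw [← hpre]
      exact isCOn_comp_linear n pair continuous_pair (ih (isAdmissible_dirDeriv h))

end WeightedProducts.WProd

end Induction

/-! ### Weights in the maximal extension are dominated -/

section Extension

variable {𝕂 : Type u𝕂} [RCLike 𝕂] {ι : Type uι} {X : ι → Type uX}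
  [∀ i, NormedAddCommGroup (X i)] [∀ i, NormedSpace 𝕂 (X i)] {U : ∀ i, Opens (X i)}
  {W : Set (Weight U)}

theorem exists_enorm_le_one_and_eq_one (𝕂 : Type*) [RCLike 𝕂] (E : Type*) [NormedAddCommGroup E]
    [NormedSpace 𝕂 E] : ∃ e : E, ‖e‖ₑ ≤ 1 ∧ (¬ Subsingleton E → ‖e‖ₑ = 1) := by
  by_cases h : Subsingleton E
  · exact ⟨0, by simp, fun h' => absurd h h'⟩
  · have := not_subsingleton_iff_nontrivial.1 h
    let : NormedSpace ℝ E := NormedSpace.restrictScalars ℝ 𝕂 E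
    obtain ⟨e, he⟩ := exists_norm_eq E zero_le_one
    have he' : ‖e‖ₑ = 1 := by rw [← ofReal_norm, he, ENNReal.ofReal_one]
    exact ⟨e, he'.le, fun _ => he'⟩

open Classical in
-- A continuous seminorm is bounded by finitely many defining ones; evaluate this on families `x ↦ u
-- x • e i` with unit vectors `e i`. The test family is `Y` itself, as the maximal extension is
-- tested on spaces in the universe of `Y`. Where `Y i` is trivial there is no unit vector, and the
-- weight is replaced by `0`.
theorem WeightedProducts.IsExtWeight.isDominated {g : Weight U}
    (hg : IsExtWeight.{u𝕂, uι, uX, uY} 𝕂 U W g) (Y : ι → Type uY) [∀ i, NormedAddCommGroup (Y i)]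
    [∀ i, NormedSpace 𝕂 (Y i)] :
    IsDominated (absWeight '' W)
      fun p : Σ i, U i => if Subsingleton (Y p.1) then 0 else absWeight g p := by
  obtain ⟨hfin, hcont⟩ := hg Y
  let q : Seminorm 𝕂 (WProd 𝕂 U Y W 0) := Seminorm.of
    (fun γ => (famNorm 𝕂 g 0 γ.toFam).toReal)
    (fun γ η => by
      rw [← ENNReal.toReal_add (hfin γ).ne (hfin η).ne]
      exact ENNReal.toReal_mono (ENNReal.add_ne_top.2 ⟨(hfin γ).ne, (hfin η).ne⟩)
        (famNorm_add_le g 0 (γ.contDiffOn (by simp)) (η.contDiffOn (by simp))))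
    (fun c γ => by
      rw [WProd.toFam_smul, famNorm_smul g 0 c (γ.contDiffOn (by simp)), ENNReal.toReal_mul,
        toReal_enorm])
  obtain ⟨s, C, -, hle⟩ := Seminorm.bound_of_continuous (WProd.withSeminorms W) q hcont
  choose e he1 he2 using fun i => exists_enorm_le_one_and_eq_one 𝕂 (Y i)
  refine ⟨s.image fun p => absWeight p.1.1, ?_, C, fun u hu hf => ?_⟩
  · intro f hf
    obtain ⟨p, -, rfl⟩ := Finset.mem_image.1 (Finset.mem_coe.1 hf)
    exact ⟨p.1.1, p.1.2, rfl⟩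
  -- Continuity of `u` and finiteness of its suprema are exactly what makes this test family an
  -- element of the weighted product with `k = 0`.
  let φ : ∀ i, X i → Y i := fun i => ext0 (U i) fun x => (u ⟨i, x⟩ : 𝕂) • e i
  have hφ : ∀ i (x : U i), φ i x = (u ⟨i, x⟩ : 𝕂) • e i := fun i x => ext0_apply (U i) _ x
  have hφn : ∀ i (x : U i), ‖φ i x‖ₑ = ‖u ⟨i, x⟩‖ₑ * ‖e i‖ₑ := fun i x => by
    rw [hφ, enorm_smul, ← ofReal_norm (_ : 𝕂), RCLike.norm_ofReal, ← Real.norm_eq_abs, ofReal_norm]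
  have hφle : ∀ f : EWeight U, wNorm 𝕂 f 0 φ ≤ wSup f u := fun f => by
    rw [wNorm_zero]
    refine iSup_mono fun p => mul_le_mul_right ?_ _
    rw [hφn]
    exact mul_le_of_le_one_right' (he1 p.1)
  have hφc : ∀ i, ContDiffOn 𝕂 (0 : ℕ∞) (φ i) (U i) := fun i => by
    refine contDiffOn_zero.2 (continuousOn_iff_continuous_domRestrict.2 ?_)
    have : (U i : Set (X i)).domRestrict (φ i) = fun x => (u ⟨i, x⟩ : 𝕂) • e i := funext (hφ i)
    rw [this]
    exact (RCLike.continuous_ofReal.comp (hu.comp continuous_sigmaMk)).smul continuous_const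
  let γ : WProd 𝕂 U Y W 0 := WProd.ofExt φ hφc fun f hf' ℓ hℓ => by
    obtain rfl : ℓ = 0 := by simpa using hℓ
    exact (hφle f).trans_lt (hf f hf')
  have hγ : ∀ f : Weight U, famNorm 𝕂 f 0 γ.toFam = wNorm 𝕂 (absWeight f) 0 φ := fun f => by
    rw [famNorm_eq_wNorm]
    exact wNorm_congr _ _ fun i x hx => WProd.ext_apply γ hx
  have hsum : ∑ f ∈ s.image (fun p => absWeight p.1.1), wSup f u < ∞ :=
    ENNReal.sum_lt_top.2 fun f hf' => by
      obtain ⟨p, -, rfl⟩ := Finset.mem_image.1 hf'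
      exact hf _ ⟨p.1.1, p.1.2, rfl⟩
  have hsup : s.sup (WProd.seminorms 𝕂 U Y W 0) γ ≤
      (∑ f ∈ s.image (fun p => absWeight p.1.1), wSup f u).toReal := by
    refine Seminorm.finset_sup_apply_le ENNReal.toReal_nonneg fun p hp => ?_
    obtain ⟨f, ℓ, hℓ⟩ := p
    obtain rfl : ℓ = 0 := by simpa using hℓ
    refine ENNReal.toReal_mono hsum.ne ((hγ f).trans_le ((hφle _).trans ?_))
    exact Finset.single_le_sum (f := fun f => wSup f u) (fun _ _ => zero_le)
      (Finset.mem_image_of_mem (fun p => absWeight p.1.1) hp)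
  have hq : (famNorm 𝕂 g 0 γ.toFam).toReal ≤
      C * (∑ f ∈ s.image (fun p => absWeight p.1.1), wSup f u).toReal :=
    (hle γ).trans (mul_le_mul_of_nonneg_left hsup C.2)
  have hq' : famNorm 𝕂 g 0 γ.toFam ≤
      C * ∑ f ∈ s.image (fun p => absWeight p.1.1), wSup f u := by
    rw [← ENNReal.toReal_le_toReal (hfin γ).ne
      (ENNReal.mul_ne_top ENNReal.coe_ne_top hsum.ne), ENNReal.toReal_mul, ENNReal.coe_toReal]
    exact hq
  refine le_trans (iSup_le fun p => ?_) hq'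
  beta_reduce
  split_ifs with hp
  · simp
  · rw [hγ]
    refine le_trans (le_of_eq ?_) (le_wNorm_zero (absWeight g) φ p.2.2)
    rw [hφn, he2 p.1 hp, mul_one]

end Extension

/-! ### The hypotheses of the theorem -/

section Hypotheses

variable {𝕂 : Type u𝕂} [RCLike 𝕂] {ι : Type uι} {X : ι → Type uX}
  [∀ i, NormedAddCommGroup (X i)] [∀ i, NormedSpace 𝕂 (X i)] {U : ∀ i, Opens (X i)}
  {Y : ι → Type uY} [∀ i, NormedAddCommGroup (Y i)] [∀ i, NormedSpace 𝕂 (Y i)]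
  {Z : ι → Type uZ} [∀ i, NormedAddCommGroup (Z i)] [∀ i, NormedSpace 𝕂 (Z i)]
  {V : ∀ i, Opens (Y i)} {W : Set (Weight U)}

theorem isAdmissible_of_isExtWeight (hV0 : ∀ i, (0 : Y i) ∈ V i)
    (hV : ∀ i, StarShaped 𝕂 (V i : Set (Y i))) {β : ∀ i, X i × Y i → Z i}
    (hβ : ∀ i, ContDiffOn 𝕂 (⊤ : ℕ∞) (β i) ((U i : Set (X i)) ×ˢ (V i : Set (Y i))))
    (hβ0 : ∀ i, ∀ x ∈ U i, β i (x, 0) = 0)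
    (hβW : ∀ f ∈ W, ∀ ℓ : ℕ, 1 ≤ ℓ → ∃ g : Weight U, IsExtWeight.{u𝕂, uι, uX, uY} 𝕂 U W g ∧
      ∀ i, ∀ x : U i,
        qnorm 𝕂 (opensProd (U i) (V i)) (fun _ => 1) ℓ (β i) * wabs (f ⟨i, x⟩) ≤
          wabs (g ⟨i, x⟩)) :
    IsAdmissible 𝕂 (absWeight '' W) (fun i => (V i : Set (Y i))) β where
  isOpen i := (V i).isOpen
  zero_mem := hV0
  starShaped := hV
  contDiffOn := hβ
  map_zero := hβ0
  bound := by
    classical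
    rintro _ ⟨f, hf, rfl⟩ ℓ hℓ R
    obtain ⟨g, hg, hle⟩ := hβW f hf ℓ hℓ
    refine ⟨_, hg.isDominated Y, fun i x hx y hy _ => ?_⟩
    have hxy : (x, y) ∈ opensProd (U i) (V i) := ⟨hx, hy⟩
    -- If `Y i` is trivial, `β i` vanishes near `(x, y)` since the second variable can only be `0`,
    -- so the weight `0` suffices there. Otherwise `g` itself gives the bound.
    split_ifs with hi
    · have h0 : β i =ᶠ[𝓝 (x, y)] fun _ => 0 :=
        Filter.eventually_of_mem ((opensProd (U i) (V i)).isOpen.mem_nhds hxy) fun z hz => by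
          rw [← hβ0 i z.1 hz.1, ← Subsingleton.elim z.2 0]
      rw [(h0.iteratedFDeriv 𝕂 ℓ).eq_of_nhds, iteratedFDeriv_fun_zero]
      simp [← ofReal_norm]
    · refine le_trans ?_ (hle i ⟨x, hx⟩)
      rw [mul_comm]
      refine mul_le_mul_left ?_ _
      have h1 := le_iSup (fun z : opensProd (U i) (V i) => wabs ((fun _ => 1 :
        opensProd (U i) (V i) → WithTop ℝ) z) * ‖iteratedFDerivWithin 𝕂 ℓ (β i)
          (opensProd (U i) (V i) : Set (X i × Y i)) (z : X i × Y i)‖ₑ) ⟨(x, y), hxy⟩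
      have h2 : wabs (1 : WithTop ℝ) = 1 := (wabs_coe 1).trans (by simp)
      rwa [h2, one_mul, iteratedFDerivWithin_of_isOpen ℓ (opensProd (U i) (V i)).isOpen hxy] at h1

/-- A ball is connected, so a ball around `0 ∈ S` that leaves the open set `S` meets `frontier S`.
The hypothesis places the frontier at distance at least `1 / |a|`, out of reach of the open ball. An
empty frontier has infinite distance and needs no separate treatment. -/
theorem ball_subset_of_inv_infEDist_frontier_le {E : Type*} [NormedAddCommGroup E]
    [NormedSpace 𝕂 E] {S : Set E} (hS : IsOpen S) (h0 : (0 : E) ∈ S) {a : ℝ}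
    (ha : (Metric.infEDist (0 : E) (frontier S))⁻¹ ≤ ‖a‖ₑ) :
    Metric.ball (0 : E) (1 / |a|) ⊆ S := by
  let : NormedSpace ℝ E := NormedSpace.restrictScalars ℝ 𝕂 E
  by_contra hnot
  have hpre : IsPreconnected (Metric.ball (0 : E) (1 / |a|)) := (convex_ball _ _).isPreconnected
  obtain ⟨y, hy, hyS⟩ := not_subset.1 hnot
  have hpos : 0 < 1 / |a| := (norm_nonneg _).trans_lt (mem_ball_zero_iff.1 hy)
  have ha0 : 0 < |a| := by simpa using hpos
  obtain ⟨z, hz, hzS⟩ : ∃ z ∈ Metric.ball (0 : E) (1 / |a|), z ∈ frontier S := by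
    by_contra! hno
    rw [hS.frontier_eq] at hno
    have hcl : ∀ z ∈ Metric.ball (0 : E) (1 / |a|), z ∉ S → z ∉ closure S :=
      fun z hz hzS hzc => hno z hz ⟨hzc, hzS⟩
    obtain ⟨z, -, hzS, hzc⟩ := hpre S (closure S)ᶜ hS isClosed_closure.isOpen_compl
      (fun z hz => or_iff_not_imp_left.2 (hcl z hz)) ⟨0, Metric.mem_ball_self hpos, h0⟩
      ⟨y, hy, hcl y hy hyS⟩
    exact hzc (subset_closure hzS)
  have h1 : Metric.infEDist (0 : E) (frontier S) ≤ ‖z‖ₑ := by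
    rw [← edist_zero_right, edist_comm]
    exact Metric.infEDist_le_edist_of_mem hzS
  have h2 : ‖z‖ₑ < ‖a‖ₑ⁻¹ := by
    rw [← ofReal_norm, ← ofReal_norm, Real.norm_eq_abs, ← ENNReal.ofReal_inv_of_pos ha0, ← one_div,
      ENNReal.ofReal_lt_ofReal_iff hpos]
    exact mem_ball_zero_iff.1 hz
  exact absurd (ENNReal.inv_le_inv.1 (by simpa using ha)) (not_le.2 (h1.trans_lt h2))

end Hypotheses

/-! ### The proposition -/

theorem mainTheorem1 {𝕂 : Type u𝕂} [RCLike 𝕂] {ι : Type uι} [Nonempty ι]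
    {X : ι → Type uX} [∀ i, NormedAddCommGroup (X i)] [∀ i, NormedSpace 𝕂 (X i)]
    {Y : ι → Type uY} [∀ i, NormedAddCommGroup (Y i)] [∀ i, NormedSpace 𝕂 (Y i)]
    {Z : ι → Type uZ} [∀ i, NormedAddCommGroup (Z i)] [∀ i, NormedSpace 𝕂 (Z i)]
    (U : ∀ i, Opens (X i)) (hU : ∀ i, (U i : Set (X i)).Nonempty)
    (V : ∀ i, Opens (Y i)) (hV0 : ∀ i, (0 : Y i) ∈ V i)
    (hV : ∀ i, StarShaped 𝕂 (V i : Set (Y i)))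
    (W : Set (Weight U))
    (ω : (Σ i, U i) → ℝ) (hω : IsAdjustingWeight U V ω)
    (hωW : (fun p => (ω p : WithTop ℝ)) ∈ W)
    (β : ∀ i, X i × Y i → Z i)
    (hβ : ∀ i, ContDiffOn 𝕂 (⊤ : ℕ∞) (β i) ((U i : Set (X i)) ×ˢ (V i : Set (Y i))))
    (hβ0 : ∀ i, ∀ x ∈ U i, β i (x, 0) = 0)
    (hβW : ∀ f ∈ W, ∀ ℓ : ℕ, 1 ≤ ℓ → ∃ g : Weight U, IsExtWeight.{u𝕂, uι, uX, uY} 𝕂 U W g ∧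
      ∀ i, ∀ x : U i,
        qnorm 𝕂 (opensProd (U i) (V i)) (fun _ => 1) ℓ (β i) * wabs (f ⟨i, x⟩) ≤ wabs (g ⟨i, x⟩))
    (k : ℕ∞) :
    IsOpen (omegaOpen 𝕂 U V W k ω) ∧ (omegaOpen 𝕂 U V W k ω).Nonempty ∧
    (∀ γ ∈ omegaOpen 𝕂 U V W k ω, ∀ i, ∀ x : U i, γ.toFam i x ∈ V i) ∧
    ∃ B : WProd 𝕂 U Y W k → WProd 𝕂 U Z W k,
      (∀ γ ∈ omegaOpen 𝕂 U V W k ω, ∀ i, ∀ x : U i,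
        (B γ).toFam i x = β i (x, γ.toFam i x)) ∧
      IsSmoothOn 𝕂 (omegaOpen 𝕂 U V W k ω) B := by
  have hω1 : ∀ p, 1 ≤ ‖ω p‖ₑ := fun ⟨i, x⟩ =>
    (le_max_right _ _).trans ((hω i).2.trans (iInf_le (fun x : U i => ‖ω ⟨i, x⟩‖ₑ) x))
  have hadm := isAdmissible_of_isExtWeight hV0 hV hβ hβ0 hβW
  have hmem : ∀ γ ∈ omegaOpen 𝕂 U V W k ω, ∀ i, ∀ x : U i, γ.toFam i x ∈ V i :=
    fun γ hγ => WProd.toFam_mem_of_mem_omegaSet hω1 hγ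
  -- The zero family is the witness for nonemptiness, with radius parameter `r = 1`: this is where
  -- the distance condition on the adjusting weight enters.
  refine ⟨WProd.isOpen_omegaSet hω1 hωW, ⟨0, 1, one_pos, fun i x => ?_⟩, hmem,
    WProd.superposMap k W β,
    fun γ hγ => WProd.toFam_superposMap hadm ⟨_, hωW, WProd.absWeight_coe ω⟩ hω1 (hmem γ hγ),
    fun n => WProd.isCOn_superposMap hω1 hωW n hadm⟩
  exact ball_subset_of_inv_infEDist_frontier_le (𝕂 := 𝕂) (V i).isOpen (hV0 i)
    ((le_max_left _ _).trans ((hω i).2.trans (iInf_le (fun x : U i => ‖ω ⟨i, x⟩‖ₑ) x)))
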